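/- Let $\mathcal X_1,\dots,\mathcal X_n$ be finite sets, $\mathcal X=\mathcal X_1\times\dots\times\mathcal X_n$, and let $\theta:\mathcal X\to\mathbb R\cup\{-\infty\}$, $\mathrm{Dom}(\theta)=\{\mathbf x:\theta(\mathbf x)\neq-\infty\}$. Let $\Gamma=\{\gamma_i(x_i): 1\le i\le n,\ x_i\in\mathcal X_i\}$ be i.i.d. zero-mean Gumbel random variables, with distribution function $G(y)=\exp(-\exp(-(y+c)))$, where $c$ is the Euler–Mascheroni constant. For $1\le j\le n+1$ and a fixed prefix $\mathbf x_{1:(j-1)}$ put $$V_j=V_j(\mathbf x_{1:(j-1)})=\max_{\mathbf x_{j:n}}\Big\{\theta(\mathbf x)+\sum_{i=j}^n\gamma_i(x_i)\Big\},$$ and call the prefix feasible if it extends to an element of $\mathrm{Dom}(\theta)$ (so that $V_j>-\infty$). For feasible prefixes $V_j$ is integrable, and the following holds. (1) For $1\le j\le n$ and a feasible prefix, $V_j$ is, as a function of the perturbations, almost everywhere differentiable with $\|\nabla V_j\|_2^2=n-j+1$ and $\|\nabla V_j\|_\infty=1$. (2) Let $1\le j\le n$, let the prefix be feasible, $M_j\ge1$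 and $0<\delta<1$, and let $U_1,\dots,U_{M_j}$ be i.i.d. with the law of $V_j-\mathbb E[V_j]$. Then with probability at least $1-\delta$, $$\Big|\frac1{M_j}\sum_{i=1}^{M_j}U_i\Big|\le B_j(M_j,\delta):=\max\left(\frac{20}{M_j}\log\frac2\delta,\ \sqrt{\frac{20(n-j+1)}{M_j}\log\frac2\delta}\right).$$ (3) Let $0<\delta<1$ and $\varepsilon>0$. For each $1\le j\le n$ all sufficiently large $M_j$ satisfy $B_j(M_j,\delta)\le\varepsilon$. Let $M_1,\dots,M_n\ge1$ be such that $B_j(M_j,\delta)\le\varepsilon$ for all $1\le j\le n$, and let $M_{n+1}\ge1$ be arbitrary ($V_{n+1}=\theta(\mathbf x)$ is deterministic). For each $1\le j\le n+1$ and each feasible prefix $\mathbf x_{1:(j-1)}$, let $\hat V_j(\mathbf x_{1:(j-1)})$ be the mean of $M_j$ i.i.d. copies of $V_j(\mathbf x_{1:(j-1)})$ (samples for different prefixes may depend on each other). For feasible $\mathbf x_{1:j}$ let $$p_j(x_j)=\frac{\exp(\mathbb E[V_{j+1}(\mathbf x_{1:j})])}{\exp(\mathbb E[V_j(\mathbf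 x_{1:(j-1)})])},\qquad \hat p_j(x_j)=\frac{\exp(\hat V_{j+1}(\mathbf x_{1:j}))}{\exp(\hat V_j(\mathbf x_{1:(j-1)}))}.$$ Then for every fixed $\mathbf x\in\mathrm{Dom}(\theta)$, with probability at least $1-n\delta$, $$\exp(-2\varepsilon)\le\frac{\hat p_j(x_j)}{p_j(x_j)}\le\exp(2\varepsilon)\qquad\text{for all } j=1,\dots,n.$$ Moreover, with probability at least $1-m\delta$, $m=\sum_{i=1}^n|\mathcal X_i|$, the bounds $\exp(-2\varepsilon)\le\hat p_j(y)/p_j(y)\le\exp(2\varepsilon)$, with the prefix $\mathbf x_{1:(j-1)}$ of the fixed $\mathbf x\in\mathrm{Dom}(\theta)$, hold simultaneously for all $j=1,\dots,n$ and all $y\in\mathcal X_j$ for which $(\mathbf x_{1:(j-1)},y)$ is feasible. -/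

import Mathlib

open MeasureTheory ProbabilityTheory Filter

noncomputable section

namespace MapPert

/-- Density of the zero-mean Gumbel law, `g(y) = exp (-(y + c + exp (-(y + c))))`, where `c` is the
Euler-Mascheroni constant. -/
def gumbelDensity (y : ℝ) : ℝ :=
  Real.exp (-(y + Real.eulerMascheroniConstant + Real.exp (-(y + Real.eulerMascheroniConstant))))

/-- The zero-mean Gumbel law on the real line. -/
def gumbelMeasure : Measure ℝ :=
  volume.withDensity (fun y => ENNReal.ofReal (gumbelDensity y))

/-- The Gumbel law has distribution function `G(y) = exp (-exp (-(y + c)))`. -/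
theorem gumbelMeasure_Iic (y : ℝ) :
    gumbelMeasure (Set.Iic y)
      = ENNReal.ofReal (Real.exp (-Real.exp (-(y + Real.eulerMascheroniConstant)))) := by
  set c := Real.eulerMascheroniConstant with hc
  set F : ℝ → ℝ := fun t => Real.exp (-Real.exp (-(t + c))) with hF
  have hderiv : ∀ t, HasDerivAt F (gumbelDensity t) t := by
    intro t
    have h1 : HasDerivAt (fun t : ℝ => -(t + c)) (-1) t := ((hasDerivAt_id t).add_const c).neg
    have h2 : HasDerivAt F
        (Real.exp (-Real.exp (-(t + c))) * -(Real.exp (-(t + c)) * -1)) t := (h1.exp.neg).exp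
    refine h2.congr_deriv ?_
    unfold gumbelDensity
    rw [← hc]
    rw [show -(t + c + Real.exp (-(t + c))) = -Real.exp (-(t + c)) + -(t + c) by ring,
      Real.exp_add]
    ring
  have hcont : Continuous gumbelDensity := by unfold gumbelDensity; fun_prop
  have hpos : ∀ t, 0 ≤ gumbelDensity t := fun t => (Real.exp_pos _).le
  have hlim : Tendsto F atBot (nhds 0) := by
    refine Real.tendsto_exp_atBot.comp (tendsto_neg_atTop_atBot.comp
      (Real.tendsto_exp_atTop.comp (tendsto_neg_atBot_atTop.comp ?_)))
    exact tendsto_atBot_add_const_right _ c tendsto_id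
  have hftc : ∀ a, ∫ t in a..y, gumbelDensity t = F y - F a := fun a =>
    intervalIntegral.integral_eq_sub_of_hasDerivAt (fun t _ => hderiv t)
      (hcont.intervalIntegrable _ _)
  have hint : IntegrableOn gumbelDensity (Set.Iic y) := by
    refine integrableOn_Iic_of_intervalIntegral_norm_tendsto (F y) y (a := id) (l := atBot)
      (fun i => hcont.integrableOn_Ioc) tendsto_id ?_
    simp only [Real.norm_of_nonneg (hpos _), id, hftc]
    simpa using tendsto_const_nhds.sub hlim
  have hval : ∫ t in Set.Iic y, gumbelDensity t = F y := by
    simpa using integral_Iic_of_hasDerivAt_of_tendsto' (fun t _ => hderiv t) hint hlim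
  rw [gumbelMeasure, withDensity_apply _ measurableSet_Iic,
    ← ofReal_integral_eq_lintegral_ofReal hint (Filter.Eventually.of_forall hpos), hval]

variable {n : ℕ} {X : Fin n → Type*}

/-- A configuration `x = (x_1, ..., x_n)`; coordinates are numbered `0, ..., n - 1`. -/
abbrev Config (X : Fin n → Type*) : Type _ := ∀ i, X i

/-- The values of the first `j` coordinates of a configuration. -/
abbrev Prefix (X : Fin n → Type*) (j : ℕ) : Type _ := ∀ i : {i : Fin n // (i : ℕ) < j}, X i.1

/-- The first `j` coordinates of `x`. -/
def pre (x : Config X) (j : ℕ) : Prefix X j := fun i => x i.1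

/-- A realization of the perturbations: one real number `γ_i(x_i)` for each coordinate `i` and each
`x_i ∈ X_i`. -/
abbrev Pert (X : Fin n → Type*) : Type _ := (Σ i, X i) → ℝ

/-- The law of i.i.d. Gumbel perturbations. -/
def gumbelProduct [∀ i, Fintype (X i)] : Measure (Pert X) := Measure.pi (fun _ => gumbelMeasure)

/-- Some configuration extending the prefix `p` has a score different from `-∞`. -/
def Feasible (θ : Config X → WithBot ℝ) (j : ℕ) (p : Prefix X j) : Prop :=
  ∃ z : Config X, pre z j = p ∧ θ z ≠ ⊥

open Classical in
/-- The MAP value when the first `j` coordinates are fixed to be `p` and the others are perturbed: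
the maximum of `θ(z) + ∑_{i ≥ j} γ_i(z_i)` over the configurations `z` extending `p`.
It is `-∞` exactly if `p` is not feasible. -/
def mapValue [∀ i, Fintype (X i)] (θ : Config X → WithBot ℝ) (j : ℕ) (p : Prefix X j)
    (γ : Pert X) : WithBot ℝ :=
  (Finset.univ.filter (fun z : Config X => pre z j = p)).sup
    (fun z => θ z + ((∑ i ∈ Finset.univ.filter (fun i : Fin n => j ≤ (i : ℕ)), γ ⟨i, z i⟩ : ℝ) :
      WithBot ℝ))

/-- The MAP value as a real number, for a feasible prefix (and `0` for the others). -/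
def V [∀ i, Fintype (X i)] (θ : Config X → WithBot ℝ) (j : ℕ) (p : Prefix X j)
    (γ : Pert X) : ℝ :=
  (mapValue θ j p γ).unbotD 0

/-- The expected MAP value, for a feasible prefix. -/
def EV [∀ i, Fintype (X i)] (θ : Config X → WithBot ℝ) (j : ℕ) (p : Prefix X j) : ℝ :=
  ∫ γ, V θ j p γ ∂gumbelProduct

open Classical in
/-- The vector of partial derivatives of a function of the perturbations. -/
def grad [∀ i, Fintype (X i)] (f : Pert X → ℝ) (γ : Pert X) : (Σ i, X i) → ℝ :=
  fun s => fderiv ℝ f γ (Pi.single s 1)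

open Classical in
/-- The probability with which the sampler extends the first `j` coordinates of `x` by the next
coordinate of `x`: the quotient of the exponentials of the two expected MAP values.
It is `exp (-∞) = 0` in the numerator if the extended prefix is not feasible. -/
def samplerProb [∀ i, Fintype (X i)] (θ : Config X → WithBot ℝ) (j : ℕ) (x : Config X) : ℝ :=
  if Feasible θ (j + 1) (pre x (j + 1)) then
    Real.exp (EV θ (j + 1) (pre x (j + 1))) / Real.exp (EV θ j (pre x j))
  else 0

/-- The mean of a finite sample. -/
def sampleMean {M : ℕ} (w : Fin M → ℝ) : ℝ := (1 / (M : ℝ)) * ∑ k, w k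

open Classical in
/-- The sampler probability with the two expectations replaced by sample means, where `w j p` is a
sample of size `M j` for the MAP value at the prefix `p` of length `j`. -/
def estimatedProb (θ : Config X → WithBot ℝ) {M : ℕ → ℕ}
    (w : ∀ j : ℕ, Prefix X j → Fin (M j) → ℝ) (j : ℕ) (x : Config X) : ℝ :=
  if Feasible θ (j + 1) (pre x (j + 1)) then
    Real.exp (sampleMean (w (j + 1) (pre x (j + 1)))) / Real.exp (sampleMean (w j (pre x j)))
  else 0

/-- The error bound for the mean of `M` centred copies of a MAP value with `d` free coordinates. -/
def errBound (d : ℝ) (M : ℕ) (δ : ℝ) : ℝ :=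
  max (20 / (M : ℝ) * Real.log (2 / δ)) (Real.sqrt (20 * d / (M : ℝ) * Real.log (2 / δ)))

/-- `Y` is a family of i.i.d. random variables with the law of `f` under `μ`. -/
def IsIIDCopies {Ω α ι : Type*} [MeasurableSpace Ω] [MeasurableSpace α] (P : Measure Ω)
    (Y : ι → Ω → ℝ) (f : α → ℝ) (μ : Measure α) : Prop :=
  iIndepFun Y P ∧ ∀ k, IdentDistrib (Y k) f P μ

end MapPert

end

open MeasureTheory ProbabilityTheory Filter

namespace MapPert

/-! ### The Gumbel law -/

/-! The deviation bound rests on E exp(t(V - E V)) ≤ exp(4dt²) for |t| ≤ 1/4, where d is the number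
of perturbed coordinates. Two facts give it.

Max-stability: freeze all perturbations outside one block γ_i(·). The maximum is then a maximum of
shifted independent Gumbel variables, hence a shifted Gumbel variable (`map_sup'_gumbelMeasure`).
Once centred it has the Gumbel moment generating function exp(-tc)Γ(1-t), which is at most exp(4t²)
for |t| ≤ 1/2 (`log_Gamma_one_add_le`). Neither the score nor the size of the block enters.

Tensorization: bounds on the centred moment generating function in each block, uniform in the frozen
blocks, multiply (`centredMgf_pi_le`). Only perturbed blocks contribute a factor. A Chernoff bound
with the right t (`exists_chernoff_parameter`) then yields `errBound`; the gradient plays no role in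
it.

For the gradient, the Gumbel law has no atoms, so the maximizer is almost surely unique and the
maximum is locally one affine function with coefficients 0 and 1.

For the sampler, the logarithm of the ratio of estimated to true probability is a difference of two
estimation errors. A union bound controls these, and prefixes of full length cost nothing because
their value is deterministic. -/

theorem sub_two_mul_sq_le_log_one_add {u : ℝ} (hu : |u| ≤ 1 / 2) :
    u - 2 * u ^ 2 ≤ Real.log (1 + u) := by
  have h := Real.abs_log_sub_add_sum_range_le (x := -u) (by rw [abs_neg]; linarith) 1
  simp only [Finset.sum_range_one, abs_neg, sub_neg_eq_add, zero_add, pow_one, Nat.cast_zero,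
    div_one, one_add_one_eq_two, sq_abs] at h
  have h2 : u ^ 2 / (1 - |u|) ≤ 2 * u ^ 2 := by
    rw [div_le_iff₀ (by linarith)]
    nlinarith [sq_nonneg u]
  have h3 := (abs_le.1 h).1
  linarith

/-- Factor 1 + s + m as (m + 1)(1 + s/(m + 1)) and apply the quadratic lower bound for the
logarithm. The errors are summed by telescoping: 1/(n + 1)² ≤ 1/(n + 1/2) - 1/(n + 3/2). The
correction 2 - 1/(n + 1/2) vanishes at n = 0 and stays below 2. -/
theorem le_sum_log_one_add {s : ℝ} (hs : |s| ≤ 1 / 2) (n : ℕ) :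
    Real.log (n.factorial : ℝ) + s * (harmonic n : ℝ) - 2 * s ^ 2 * (2 - 1 / ((n : ℝ) + 1 / 2))
      ≤ ∑ m ∈ Finset.range n, Real.log (1 + s + m) := by
  induction n with
  | zero => norm_num
  | succ n ih =>
    have hn : (0 : ℝ) ≤ n := n.cast_nonneg
    have hn1 : (0 : ℝ) < (n : ℝ) + 1 := by linarith
    have hs' : |s / (n + 1)| ≤ 1 / 2 := by
      rw [abs_div, abs_of_pos hn1, div_le_iff₀ hn1]
      nlinarith
    have hlog : Real.log (1 + s + n) = Real.log (n + 1) + Real.log (1 + s / (n + 1)) := by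
      rw [← Real.log_mul hn1.ne' (by linarith [(abs_le.1 hs').1])]
      congr 1
      field_simp
      ring
    have h1 := sub_two_mul_sq_le_log_one_add hs'
    have h2 : (s / (n + 1)) ^ 2
        ≤ s ^ 2 * (1 / ((n : ℝ) + 1 / 2) - 1 / (((n : ℝ) + 1) + 1 / 2)) := by
      rw [div_pow, div_eq_mul_one_div]
      refine mul_le_mul_of_nonneg_left ?_ (sq_nonneg s)
      rw [div_sub_div _ _ (by positivity) (by positivity),
        div_le_div_iff₀ (by positivity) (by positivity)]
      nlinarith
    rw [Finset.sum_range_succ, hlog, harmonic_succ, Nat.factorial_succ]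
    push_cast
    rw [Real.log_mul hn1.ne' (by positivity)]
    have h3 : s * ((harmonic n : ℝ) + ((n : ℝ) + 1)⁻¹) = s * harmonic n + s / (n + 1) := by ring
    linarith

/-- Euler's limit for log Γ, compared term by term with the harmonic sum, whose difference from log
n tends to the Euler–Mascheroni constant. -/
theorem log_Gamma_one_add_le {s : ℝ} (hs : |s| ≤ 1 / 2) :
    Real.log (Real.Gamma (1 + s)) ≤ -(s * Real.eulerMascheroniConstant) + 4 * s ^ 2 := by
  have hs1 := abs_le.1 hs
  have h1 := Real.BohrMollerup.tendsto_log_gamma (x := 1 + s) (by linarith)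
  have h2 : Tendsto (fun n => -(s * Real.eulerMascheroniSeq' n) + 4 * s ^ 2) atTop
      (nhds (-(s * Real.eulerMascheroniConstant) + 4 * s ^ 2)) :=
    ((Real.tendsto_eulerMascheroniSeq'.const_mul s).neg).add_const _
  refine le_of_tendsto_of_tendsto h1 h2 ?_
  filter_upwards [eventually_ge_atTop 1] with n hn
  have hn' : (1 : ℝ) ≤ n := by exact_mod_cast hn
  have h3 := le_sum_log_one_add hs n
  -- The last term of Euler's product absorbs the surplus log n in (1 + s) log n.
  have h4 : Real.log n ≤ Real.log (1 + s + n) := Real.log_le_log (by linarith) (by linarith)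
  have h5 : 0 ≤ s ^ 2 * (1 / ((n : ℝ) + 1 / 2)) := by positivity
  rw [Real.BohrMollerup.logGammaSeq, Finset.sum_range_succ, Real.eulerMascheroniSeq',
    if_neg (by omega)]
  nlinarith

theorem hasDerivAt_exp_neg_add (c y : ℝ) :
    HasDerivAt (fun y : ℝ => Real.exp (-(y + c))) (-Real.exp (-(y + c))) y := by
  have h1 : HasDerivAt (fun t : ℝ => -(t + c)) (-1) y := ((hasDerivAt_id y).add_const c).neg
  simpa using h1.exp

theorem gumbelDensity_nonneg (y : ℝ) : 0 ≤ gumbelDensity y := (Real.exp_pos _).le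

theorem continuous_gumbelDensity : Continuous gumbelDensity := by
  unfold gumbelDensity; fun_prop

/-- The substitution u = exp(-(y + c)) turns the Gamma integrand at 1 - t into the exponentially
tilted Gumbel density, up to the factor exp(tc). -/
theorem gumbelDensity_smul_exp (t y : ℝ) :
    |-Real.exp (-(y + Real.eulerMascheroniConstant))| •
        (Real.exp (-Real.exp (-(y + Real.eulerMascheroniConstant)))
          * Real.exp (-(y + Real.eulerMascheroniConstant)) ^ ((1 - t) - 1))
      = Real.exp (t * Real.eulerMascheroniConstant) * (gumbelDensity y * Real.exp (t * y)) := by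
  rw [abs_neg, abs_of_pos (Real.exp_pos _), ← Real.exp_mul, gumbelDensity, smul_eq_mul,
    ← Real.exp_add, ← Real.exp_add, ← Real.exp_add, ← Real.exp_add]
  congr 1
  ring

theorem exp_neg_add_image (c : ℝ) :
    (fun y : ℝ => Real.exp (-(y + c))) '' Set.univ = Set.Ioi 0 := by
  ext u
  simp only [Set.image_univ, Set.mem_range, Set.mem_Ioi]
  constructor
  · rintro ⟨y, rfl⟩
    exact Real.exp_pos _
  · intro hu
    exact ⟨-Real.log u - c, by rw [show -(-Real.log u - c + c) = Real.log u by ring,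
      Real.exp_log hu]⟩

theorem exp_neg_add_injOn (c : ℝ) :
    Set.InjOn (fun y : ℝ => Real.exp (-(y + c))) Set.univ := by
  intro a _ b _ h
  simpa using h

theorem integrable_gumbelDensity_mul_exp {t : ℝ} (ht : t < 1) :
    Integrable (fun y => gumbelDensity y * Real.exp (t * y)) := by
  have h := Real.GammaIntegral_convergent (s := 1 - t) (by linarith)
  rw [← exp_neg_add_image Real.eulerMascheroniConstant,
    integrableOn_image_iff_integrableOn_abs_deriv_smul MeasurableSet.univ
      (fun y _ => (hasDerivAt_exp_neg_add _ y).hasDerivWithinAt) (exp_neg_add_injOn _)] at h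
  simp only [gumbelDensity_smul_exp, integrableOn_univ] at h
  rwa [integrable_const_mul_iff (IsUnit.mk0 _ (Real.exp_pos _).ne')] at h

theorem integral_gumbelDensity_mul_exp {t : ℝ} (ht : t < 1) :
    ∫ y, gumbelDensity y * Real.exp (t * y)
      = Real.exp (-(t * Real.eulerMascheroniConstant)) * Real.Gamma (1 - t) := by
  rw [Real.Gamma_eq_integral (by linarith), ← exp_neg_add_image Real.eulerMascheroniConstant,
    integral_image_eq_integral_abs_deriv_smul MeasurableSet.univ
      (fun y _ => (hasDerivAt_exp_neg_add _ y).hasDerivWithinAt) (exp_neg_add_injOn _)]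
  simp only [gumbelDensity_smul_exp, setIntegral_univ, integral_const_mul]
  rw [← mul_assoc, ← Real.exp_add, neg_add_cancel, Real.exp_zero, one_mul]

instance isProbabilityMeasure_gumbelMeasure : IsProbabilityMeasure gumbelMeasure := by
  constructor
  have h0 := integrable_gumbelDensity_mul_exp zero_lt_one
  have h := integral_gumbelDensity_mul_exp zero_lt_one
  simp only [zero_mul, Real.exp_zero, mul_one, neg_zero, sub_zero, Real.Gamma_one] at h h0
  rw [gumbelMeasure, withDensity_apply _ MeasurableSet.univ, Measure.restrict_univ,
    ← ofReal_integral_eq_lintegral_ofReal h0 (Eventually.of_forall gumbelDensity_nonneg),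
    h, ENNReal.ofReal_one]

instance noAtoms_gumbelMeasure : NullSingletonClass gumbelMeasure := by
  unfold gumbelMeasure; infer_instance

theorem integrable_exp_mul_gumbelMeasure {t : ℝ} (ht : t < 1) :
    Integrable (fun y => Real.exp (t * y)) gumbelMeasure := by
  rw [gumbelMeasure, integrable_withDensity_iff_integrable_smul'
    continuous_gumbelDensity.measurable.ennreal_ofReal (by simp)]
  refine (integrable_gumbelDensity_mul_exp ht).congr (Eventually.of_forall fun y => ?_)
  simp only [smul_eq_mul]
  rw [ENNReal.toReal_ofReal (gumbelDensity_nonneg y)]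

theorem mgf_gumbelMeasure {t : ℝ} (ht : t < 1) :
    mgf id gumbelMeasure t
      = Real.exp (-(t * Real.eulerMascheroniConstant)) * Real.Gamma (1 - t) := by
  rw [mgf, gumbelMeasure, integral_withDensity_eq_integral_toReal_smul
    continuous_gumbelDensity.measurable.ennreal_ofReal (by simp),
    ← integral_gumbelDensity_mul_exp ht]
  refine integral_congr_ae (Eventually.of_forall fun y => ?_)
  simp only [smul_eq_mul, id]
  rw [ENNReal.toReal_ofReal (gumbelDensity_nonneg y)]

theorem zero_mem_interior_integrableExpSet_gumbelMeasure :
    (0 : ℝ) ∈ interior (integrableExpSet id gumbelMeasure) := by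
  rw [mem_interior_iff_mem_nhds]
  filter_upwards [Iio_mem_nhds zero_lt_one] with t ht
  exact integrable_exp_mul_gumbelMeasure ht

theorem integrable_id_gumbelMeasure : Integrable (fun y : ℝ => y) gumbelMeasure :=
  integrable_of_mem_interior_integrableExpSet zero_mem_interior_integrableExpSet_gumbelMeasure

/-- The mean is the derivative at 0 of exp(-tc)Γ(1-t), where -c cancels against -Γ'(1) = c. -/
theorem integral_id_gumbelMeasure : ∫ y, y ∂gumbelMeasure = 0 := by
  have h := deriv_mgf_zero zero_mem_interior_integrableExpSet_gumbelMeasure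
  have h1 : mgf id gumbelMeasure =ᶠ[nhds 0] fun t =>
      Real.exp (-(t * Real.eulerMascheroniConstant)) * Real.Gamma (1 - t) := by
    filter_upwards [Iio_mem_nhds zero_lt_one] with t ht
    exact mgf_gumbelMeasure ht
  have hG : HasDerivAt Real.Gamma (-Real.eulerMascheroniConstant) (1 - 0) := by
    rw [sub_zero]
    exact Real.hasDerivAt_Gamma_one
  have h2 := (((hasDerivAt_id (0 : ℝ)).mul_const Real.eulerMascheroniConstant).neg.exp).mul
    (hG.comp (0 : ℝ) ((hasDerivAt_id (0 : ℝ)).const_sub 1))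
  have h3 := h1.deriv_eq.trans h2.deriv
  rw [h3] at h
  simp at h
  simpa using h.symm

theorem mgf_gumbelMeasure_le {t : ℝ} (ht : |t| ≤ 1 / 2) :
    ∫ y, Real.exp (t * y) ∂gumbelMeasure ≤ Real.exp (4 * t ^ 2) := by
  have ht1 := abs_le.1 ht
  have h := mgf_gumbelMeasure (t := t) (by linarith)
  simp only [mgf, id] at h
  have h1 := log_Gamma_one_add_le (s := -t) (by rwa [abs_neg])
  have hpos : 0 < Real.Gamma (1 + -t) := Real.Gamma_pos_of_pos (by linarith)
  rw [h, sub_eq_add_neg, ← Real.exp_log hpos, ← Real.exp_add, Real.exp_le_exp]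
  linarith [neg_sq t]

theorem integrable_exp_mul_abs_gumbelMeasure {c : ℝ} (hc : |c| < 1) :
    Integrable (fun y => Real.exp (c * |y|)) gumbelMeasure :=
  integrable_exp_mul_abs (X := id) (integrable_exp_mul_gumbelMeasure (abs_lt.1 hc).2)
    (integrable_exp_mul_gumbelMeasure (by linarith [(abs_lt.1 hc).1]))

/-! ### Tensorization of centred exponential moments -/

/-- A nonnegative integrable function `g` whose exponential moment of order `c` is finite. -/
structure ExpDom {α : Type*} [MeasurableSpace α] (μ : Measure α) (c : ℝ) (g : α → ℝ) : Prop where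
  measurable : Measurable g
  nonneg : ∀ a, 0 ≤ g a
  integrable : Integrable g μ
  integrable_exp : Integrable (fun a => Real.exp (c * g a)) μ

/-- The moment generating function of the centred random variable `f - E f`. -/
noncomputable def centredMgf {α : Type*} [MeasurableSpace α] (μ : Measure α) (f : α → ℝ) (t : ℝ) : ℝ :=
  ∫ a, Real.exp (t * (f a - ∫ a', f a' ∂μ)) ∂μ

namespace ExpDom

variable {α β : Type*} [MeasurableSpace α] [MeasurableSpace β] {μ : Measure α} {ν : Measure β}
  {c C t : ℝ} {g : α → ℝ} {h : β → ℝ}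

theorem integrable_exp_of_le (hg : ExpDom μ c g) (ht : |t| ≤ c) {F : α → ℝ} (hF : Measurable F)
    (hb : ∀ a, |F a| ≤ C + g a) : Integrable (fun a => Real.exp (t * F a)) μ := by
  refine (hg.integrable_exp.const_mul (Real.exp (c * C))).mono'
    (hF.const_mul t).exp.aestronglyMeasurable (Eventually.of_forall fun a => ?_)
  rw [Real.norm_of_nonneg (Real.exp_pos _).le, ← Real.exp_add, Real.exp_le_exp, ← mul_add]
  calc t * F a ≤ |t| * |F a| := (le_abs_self _).trans_eq (abs_mul _ _)
    _ ≤ c * |F a| := mul_le_mul_of_nonneg_right ht (abs_nonneg _)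
    _ ≤ c * (C + g a) := mul_le_mul_of_nonneg_left (hb a) ((abs_nonneg t).trans ht)

theorem two_mul (hg : ExpDom μ (2 * c) g) : ExpDom μ c (fun a => 2 * g a) where
  measurable := hg.measurable.const_mul 2
  nonneg a := mul_nonneg zero_le_two (hg.nonneg a)
  integrable := hg.integrable.const_mul 2
  integrable_exp := by
    convert! hg.integrable_exp using 3
    ring

theorem half (hc : 0 ≤ c) (hg : ExpDom μ (2 * c) g) : ExpDom μ c g where
  measurable := hg.measurable
  nonneg := hg.nonneg
  integrable := hg.integrable
  integrable_exp := hg.integrable_exp_of_le (C := 0) (by rw [abs_of_nonneg hc]; linarith)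
    hg.measurable (fun a => by rw [abs_of_nonneg (hg.nonneg a), zero_add])

variable [IsProbabilityMeasure μ] [IsProbabilityMeasure ν]

theorem integrable_of_le (hg : ExpDom μ c g) {F : α → ℝ} (hF : Measurable F)
    (hb : ∀ a, |F a| ≤ C + g a) : Integrable F μ :=
  ((integrable_const C).add hg.integrable).mono' hF.aestronglyMeasurable
    (Eventually.of_forall hb)

theorem prod (hg : ExpDom μ c g) (hh : ExpDom ν c h) :
    ExpDom (μ.prod ν) c (fun z => g z.1 + h z.2) where
  measurable := (hg.measurable.comp measurable_fst).add (hh.measurable.comp measurable_snd)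
  nonneg z := add_nonneg (hg.nonneg _) (hh.nonneg _)
  integrable := (hg.integrable.comp_fst ν).add (hh.integrable.comp_snd μ)
  integrable_exp := by
    simp only [mul_add, Real.exp_add]
    exact hg.integrable_exp.mul_prod hh.integrable_exp

theorem pi {ι : Type*} [Fintype ι] {α : ι → Type*} [∀ i, MeasurableSpace (α i)]
    {μ : ∀ i, Measure (α i)} [∀ i, IsProbabilityMeasure (μ i)] {g : ∀ i, α i → ℝ}
    (hg : ∀ i, ExpDom (μ i) c (g i)) :
    ExpDom (Measure.pi μ) c (fun x => ∑ i, g i (x i)) where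
  measurable := Finset.measurable_sum _ fun i _ => (hg i).measurable.comp (measurable_pi_apply i)
  nonneg x := Finset.sum_nonneg fun i _ => (hg i).nonneg _
  integrable := integrable_finsetSum _ fun i _ => integrable_comp_eval (hg i).integrable
  integrable_exp := by
    simp only [Finset.mul_sum, Real.exp_sum]
    exact Integrable.fintype_prod_dep (f := fun i a => Real.exp (c * g i a))
      fun i => (hg i).integrable_exp

theorem abs_integral_le (hg : ExpDom μ c g) {F : α → ℝ} (hF : Measurable F)
    (hb : ∀ a, |F a| ≤ C + g a) : |∫ a, F a ∂μ| ≤ C + ∫ a, g a ∂μ := by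
  calc |∫ a, F a ∂μ| ≤ ∫ a, |F a| ∂μ := abs_integral_le_integral_abs
    _ ≤ ∫ a, (C + g a) ∂μ := integral_mono (hg.integrable_of_le hF hb).abs
        ((integrable_const C).add hg.integrable) hb
    _ = C + ∫ a, g a ∂μ := by
        rw [integral_add (integrable_const C) hg.integrable]
        simp

end ExpDom

section TwoFactors

variable {α β : Type*} [MeasurableSpace α] [MeasurableSpace β] {μ : Measure α} {ν : Measure β}
  [IsProbabilityMeasure μ] [IsProbabilityMeasure ν] {c C t : ℝ} {g : α → ℝ} {h : β → ℝ}
  {G : α → β → ℝ}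

/-- Averaging over an independent variable does not increase centred exponential moments. -/
theorem centredMgf_integral_le (hG : Measurable (Function.uncurry G))
    (hb : ∀ a b, |G a b| ≤ C + (g a + h b)) (hg : ExpDom μ (2 * c) g) (hh : ExpDom ν (2 * c) h)
    (ht : |t| ≤ c) {K : ℝ} (hK : ∀ a, centredMgf ν (G a) t ≤ K) :
    centredMgf ν (fun b => ∫ a, G a b ∂μ) t ≤ K := by
  have hc : 0 ≤ c := (abs_nonneg t).trans ht
  have hGi : Integrable (Function.uncurry G) (μ.prod ν) :=
    ((hg.half hc).prod (hh.half hc)).integrable_of_le hG fun z => hb z.1 z.2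
  have hGb : ∀ b, Integrable (fun a => G a b) μ := fun b =>
    hg.integrable_of_le (C := C + h b) (hG.comp (measurable_id.prodMk measurable_const))
      (fun a => by linarith [hb a b])
  set H : α → β → ℝ := fun a b => G a b - ∫ b', G a b' ∂ν with hH
  have hmean : Measurable fun a => ∫ b', G a b' ∂ν :=
    (StronglyMeasurable.integral_prod_right hG.stronglyMeasurable).measurable
  have hHm : Measurable (Function.uncurry H) := hG.sub (hmean.comp measurable_fst)
  have hmeanle : ∀ a, |∫ b', G a b' ∂ν| ≤ (C + g a) + ∫ b, h b ∂ν := fun a =>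
    hh.abs_integral_le (hG.comp (measurable_const.prodMk measurable_id))
      (fun b => by linarith [hb a b])
  -- Centring in `b` doubles the envelope in `a`, which is why a moment of order `2 * c` is assumed.
  have hHb : ∀ a b, |H a b| ≤ (2 * C + ∫ b, h b ∂ν) + (2 * g a + h b) := fun a b => by
    have := abs_sub (G a b) (∫ b', G a b' ∂ν)
    linarith [hb a b, hmeanle a]
  have hHe : Integrable (fun z : α × β => Real.exp (t * H z.1 z.2)) (μ.prod ν) :=
    (hg.two_mul.prod (hh.half hc)).integrable_exp_of_le ht hHm fun z => hHb z.1 z.2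
  have hHeb : ∀ b, Integrable (fun a => Real.exp (t * H a b)) μ := fun b =>
    hg.two_mul.integrable_exp_of_le (C := (2 * C + ∫ b, h b ∂ν) + h b) ht
      (hHm.comp (measurable_id.prodMk measurable_const)) (fun a => by linarith [hHb a b])
  have hmeani : Integrable (fun a => ∫ b', G a b' ∂ν) μ := hGi.integral_prod_left
  -- By Fubini the centred average is the average over `a` of the centred sections `H a b`; Jensen's
  -- inequality moves the exponential inside.
  have hkey : ∀ b, Real.exp (t * ((∫ a, G a b ∂μ) - ∫ b', ∫ a, G a b' ∂μ ∂ν))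
      ≤ ∫ a, Real.exp (t * H a b) ∂μ := fun b => by
    have h1 : t * ((∫ a, G a b ∂μ) - ∫ b', ∫ a, G a b' ∂μ ∂ν) = ∫ a, t * H a b ∂μ := by
      rw [integral_const_mul, integral_sub (hGb b) hmeani, integral_integral_swap hGi]
    rw [h1]
    exact convexOn_exp.map_integral_le Real.continuous_exp.continuousOn isClosed_univ
      (Eventually.of_forall fun _ => Set.mem_univ _)
      (((hGb b).sub hmeani).const_mul t) (hHeb b)
  calc centredMgf ν (fun b => ∫ a, G a b ∂μ) t
      ≤ ∫ b, ∫ a, Real.exp (t * H a b) ∂μ ∂ν :=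
        integral_mono_of_nonneg (Eventually.of_forall fun _ => (Real.exp_pos _).le)
          hHe.integral_prod_right (Eventually.of_forall hkey)
    _ = ∫ a, ∫ b, Real.exp (t * H a b) ∂ν ∂μ := (integral_integral_swap hHe).symm
    _ ≤ ∫ _, K ∂μ := integral_mono hHe.integral_prod_left (integrable_const K) hK
    _ = K := by simp

/-- Write G - E G = (G - E_a G) + (E_a G - E G). The second summand depends on `b` only, and for
each fixed `b` the first has exponential moment at most `A`. -/
theorem centredMgf_prod_le (hG : Measurable (Function.uncurry G))
    (hb : ∀ a b, |G a b| ≤ C + (g a + h b)) (hg : ExpDom μ c g) (hh : ExpDom ν c h)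
    (ht : |t| ≤ c) {A B : ℝ} (hA : ∀ b, centredMgf μ (fun a => G a b) t ≤ A)
    (hA0 : 0 ≤ A) (hB : centredMgf ν (fun b => ∫ a, G a b ∂μ) t ≤ B) :
    centredMgf (μ.prod ν) (Function.uncurry G) t ≤ A * B := by
  have hGi : Integrable (Function.uncurry G) (μ.prod ν) :=
    (hg.prod hh).integrable_of_le hG fun z => hb z.1 z.2
  set m : ℝ := ∫ z, Function.uncurry G z ∂(μ.prod ν) with hm
  set f : β → ℝ := fun b => ∫ a, G a b ∂μ with hf
  have hmf : ∫ b, f b ∂ν = m := by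
    rw [hm, integral_prod_symm _ hGi]
    rfl
  have hfm : Measurable f :=
    (StronglyMeasurable.integral_prod_left hG.stronglyMeasurable).measurable
  have hfb : ∀ b, |f b| ≤ (C + ∫ a, g a ∂μ) + h b := fun b => by
    have := hg.abs_integral_le (C := C + h b) (F := fun a => G a b)
      (hG.comp (measurable_id.prodMk measurable_const)) (fun a => by linarith [hb a b])
    linarith
  have hfe : Integrable (fun b => Real.exp (t * (f b - m))) ν :=
    hh.integrable_exp_of_le (C := (C + ∫ a, g a ∂μ) + |m|) ht (hfm.sub_const m) fun b => by
      have := abs_sub (f b) m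
      linarith [hfb b]
  have hGe : Integrable (fun z : α × β => Real.exp (t * (G z.1 z.2 - m))) (μ.prod ν) :=
    (hg.prod hh).integrable_exp_of_le (C := C + |m|) ht (hG.sub_const m) fun z => by
      have := abs_sub (G z.1 z.2) m
      show |G z.1 z.2 - m| ≤ _
      linarith [hb z.1 z.2]
  have hin : ∀ b, ∫ a, Real.exp (t * (G a b - m)) ∂μ
      ≤ A * Real.exp (t * (f b - m)) := fun b => by
    have h1 : ∀ a, Real.exp (t * (G a b - m))
        = Real.exp (t * (G a b - f b)) * Real.exp (t * (f b - m)) := fun a => by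
      rw [← Real.exp_add]; congr 1; ring
    simp only [h1, integral_mul_const]
    exact mul_le_mul_of_nonneg_right (hA b) (Real.exp_pos _).le
  calc centredMgf (μ.prod ν) (Function.uncurry G) t
      = ∫ b, ∫ a, Real.exp (t * (G a b - m)) ∂μ ∂ν := integral_prod_symm _ hGe
    _ ≤ ∫ b, A * Real.exp (t * (f b - m)) ∂ν :=
        integral_mono hGe.integral_prod_right (hfe.const_mul A) hin
    _ = A * centredMgf ν f t := by rw [integral_const_mul, centredMgf, hmf]
    _ ≤ A * B := mul_le_mul_of_nonneg_left hB hA0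

end TwoFactors

theorem centredMgf_comp {α β : Type*} [MeasurableSpace α] [MeasurableSpace β] {μ : Measure α}
    {ν : Measure β} {e : α → β} (he : MeasurePreserving e μ ν) (he' : MeasurableEmbedding e)
    (f : β → ℝ) (t : ℝ) : centredMgf μ (f ∘ e) t = centredMgf ν f t := by
  simp only [centredMgf, Function.comp_apply]
  rw [he.integral_comp he' f, he.integral_comp he' fun b => Real.exp (t * (f b - ∫ b', f b' ∂ν))]

theorem cons_update_succ {n : ℕ} {α : Fin (n + 1) → Type*} (a : α 0) (b : ∀ i : Fin n, α i.succ)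
    (i : Fin n) (s : α i.succ) :
    (Fin.cons a (Function.update b i s) : ∀ i, α i) = Function.update (Fin.cons a b) i.succ s :=
  Fin.cons_update _ _ _ _

theorem measurePreserving_finCons {n : ℕ} {α : Fin (n + 1) → Type*} [∀ i, MeasurableSpace (α i)]
    (μ : ∀ i, Measure (α i)) [∀ i, IsProbabilityMeasure (μ i)] :
    ∃ e : (α 0 × ∀ i : Fin n, α i.succ) ≃ᵐ ∀ i, α i, (∀ z, e z = Fin.cons z.1 z.2) ∧
      MeasurePreserving e ((μ 0).prod (Measure.pi fun i => μ i.succ)) (Measure.pi μ) := by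
  refine ⟨(MeasurableEquiv.piFinSuccAbove α 0).symm, fun z => ?_,
    (measurePreserving_piFinSuccAbove μ 0).symm _⟩
  exact Fin.insertNth_zero z.1 z.2

/-- Induction on the number of factors, averaging out coordinate 0. The averaged function inherits
the one-coordinate bounds through `centredMgf_integral_le`, so no independence between increments is
needed beyond the product structure. -/
theorem centredMgf_pi_le {c t : ℝ} (ht : |t| ≤ c) : ∀ {n : ℕ} {α : Fin n → Type*}
    [∀ i, MeasurableSpace (α i)] (μ : ∀ i, Measure (α i)) [∀ i, IsProbabilityMeasure (μ i)]
    {g : ∀ i, α i → ℝ} (_ : ∀ i, ExpDom (μ i) (2 * c) (g i))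
    {F : (∀ i, α i) → ℝ} (_ : Measurable F) {C : ℝ} (_ : ∀ x, |F x| ≤ C + ∑ i, g i (x i))
    {κ : Fin n → ℝ} (_ : ∀ i x, centredMgf (μ i) (fun s => F (Function.update x i s)) t
      ≤ Real.exp (κ i)),
    centredMgf (Measure.pi μ) F t ≤ Real.exp (∑ i, κ i) := by
  have hc : 0 ≤ c := (abs_nonneg t).trans ht
  intro n
  induction n with
  | zero =>
    intro α _ μ _ g hg F hF C hb κ hκ
    have hconst : F = fun _ => F default := funext fun x => congrArg F (Subsingleton.elim _ _)
    rw [hconst]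
    simp [centredMgf]
  | succ n ih =>
    intro α _ μ _ g hg F hF C hb κ hκ
    obtain ⟨e, he, hep⟩ := measurePreserving_finCons μ
    set G : α 0 → (∀ i : Fin n, α i.succ) → ℝ := fun a b => F (Fin.cons a b) with hG
    have hGe : Function.uncurry G = F ∘ e := by
      ext z
      simp [hG, he, Function.uncurry]
    have hGm : Measurable (Function.uncurry G) := hGe ▸ hF.comp e.measurable
    have hg' := ExpDom.pi fun i : Fin n => hg i.succ
    have hGb : ∀ a b, |G a b| ≤ C + (g 0 a + ∑ i : Fin n, g i.succ (b i)) := fun a b => by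
      have := hb (Fin.cons a b)
      rwa [Fin.sum_univ_succ] at this
    rw [← centredMgf_comp hep e.measurableEmbedding, ← hGe, Fin.sum_univ_succ, Real.exp_add]
    refine centredMgf_prod_le hGm hGb ((hg 0).half hc) (hg'.half hc) ht (fun b => ?_)
      (Real.exp_pos _).le ?_
    -- The value put in coordinate 0 is arbitrary, since the update overwrites it.
    · have := hκ 0 (Fin.cons (Classical.choice (μ 0).nonempty_of_neZero) b)
      simpa only [Fin.update_cons_zero] using this
    · refine ih (fun i => μ i.succ) (fun i => hg i.succ)
        (C := C + ∫ a, g 0 a ∂(μ 0))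
        (StronglyMeasurable.integral_prod_left hGm.stronglyMeasurable).measurable
        (fun b => ?_) (fun i b => ?_)
      · have := (hg 0).abs_integral_le (C := C + ∑ i : Fin n, g i.succ (b i))
          (F := fun a => G a b) (hGm.comp (measurable_id.prodMk measurable_const))
          (fun a => by linarith [hGb a b])
        linarith
      -- Only coordinate `i` varies here, so the envelopes of the other frozen coordinates go into
      -- the constant.
      · refine centredMgf_integral_le (C := C + ∑ j ∈ Finset.univ.erase i, g j.succ (b j))
          (G := fun a s => G a (Function.update b i s))
          (g := g 0) (h := g i.succ) ?_ (fun a s => ?_) (hg 0) (hg i.succ) ht (fun a => ?_)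
        · exact hGm.comp (measurable_fst.prodMk ((measurable_update b).comp measurable_snd))
        · have h1 := hGb a (Function.update b i s)
          rw [← Finset.add_sum_erase _ _ (Finset.mem_univ i), Function.update_self] at h1
          have h2 : ∑ j ∈ Finset.univ.erase i, g j.succ (Function.update b i s j)
              = ∑ j ∈ Finset.univ.erase i, g j.succ (b j) :=
            Finset.sum_congr rfl fun j hj => by
              rw [Function.update_of_ne (Finset.ne_of_mem_erase hj)]
          rw [h2] at h1
          linarith
        · have := hκ i.succ (Fin.cons a b)
          simpa only [hG, cons_update_succ] using this

/-! ### Max-stability of the Gumbel law -/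

theorem centredMgf_map {α : Type*} [MeasurableSpace α] {μ : Measure α} {f : α → ℝ}
    (hf : Measurable f) (t : ℝ) : centredMgf (μ.map f) (fun y => y) t = centredMgf μ f t := by
  simp only [centredMgf]
  rw [integral_map hf.aemeasurable (by fun_prop), integral_map hf.aemeasurable (by fun_prop)]

theorem expDom_abs_gumbelMeasure {c : ℝ} (hc : |c| < 1) :
    ExpDom gumbelMeasure c (fun y => |y|) where
  measurable := measurable_abs
  nonneg := abs_nonneg
  integrable := integrable_id_gumbelMeasure.abs
  integrable_exp := integrable_exp_mul_abs_gumbelMeasure hc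

/-- Distribution functions of the form exp(-w exp(-(t + c))) multiply by adding their weights `w`,
the mechanism behind max-stability. The empty set gets weight 0, covering variables that occur in no
term of the maximum. -/
theorem gumbelMeasure_setOf_forall_add_le {ι : Type*} (S : Finset ι) (b : ι → ℝ) :
    ∃ w : ℝ, 0 ≤ w ∧ (S.Nonempty → 0 < w) ∧ ∀ t : ℝ,
      gumbelMeasure {u | ∀ z ∈ S, b z + u ≤ t} = ENNReal.ofReal
        (Real.exp (-(w * Real.exp (-(t + Real.eulerMascheroniConstant))))) := by
  rcases S.eq_empty_or_nonempty with rfl | hS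
  · exact ⟨0, le_rfl, fun h => absurd h (by simp), fun t => by simp⟩
  · refine ⟨Real.exp (S.sup' hS b), (Real.exp_pos _).le, fun _ => Real.exp_pos _, fun t => ?_⟩
    have : {u | ∀ z ∈ S, b z + u ≤ t} = Set.Iic (t - S.sup' hS b) := by
      ext u
      rw [Set.mem_Iic, le_sub_comm, Finset.sup'_le_iff]
      exact forall₂_congr fun z _ => le_sub_iff_add_le.symm
    rw [this, gumbelMeasure_Iic, ← Real.exp_add]
    congr 5
    ring

/-- The maximum of finitely many shifted independent Gumbel variables is a shifted Gumbel
variable. -/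
theorem map_sup'_gumbelMeasure {ι κ : Type*} [Fintype κ] (Z : Finset ι) (hZ : Z.Nonempty)
    (φ : ι → κ) (b : ι → ℝ) : ∃ m : ℝ,
      (Measure.pi fun _ : κ => gumbelMeasure).map (fun s => Z.sup' hZ fun z => b z + s (φ z))
        = gumbelMeasure.map (fun y => y + m) := by
  classical
  -- Several terms may use the same Gumbel variable, so they are grouped by the fibres of `φ`; each
  -- fibre constrains a single independent coordinate.
  choose w hw0 hwpos hw using fun y : κ =>
    gumbelMeasure_setOf_forall_add_le (Z.filter fun z => φ z = y) b
  have hW : 0 < ∑ y, w y := by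
    obtain ⟨z, hz⟩ := hZ
    exact Finset.sum_pos' (fun y _ => hw0 y)
      ⟨φ z, Finset.mem_univ _, hwpos _ ⟨z, by simp [hz]⟩⟩
  refine ⟨Real.log (∑ y, w y), ?_⟩
  have hmeas : Measurable fun s : κ → ℝ => Z.sup' hZ fun z => b z + s (φ z) :=
    (Continuous.finset_sup'_apply hZ fun z _ => by fun_prop).measurable
  have := Measure.isProbabilityMeasure_map
    (μ := Measure.pi fun _ : κ => gumbelMeasure) hmeas.aemeasurable
  refine Measure.ext_of_Iic _ _ fun t => ?_
  rw [Measure.map_apply hmeas measurableSet_Iic,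
    Measure.map_apply (by fun_prop) measurableSet_Iic]
  have h1 : (fun s : κ → ℝ => Z.sup' hZ fun z => b z + s (φ z)) ⁻¹' Set.Iic t
      = Set.univ.pi fun y => {u | ∀ z ∈ Z.filter fun z => φ z = y, b z + u ≤ t} := by
    ext s
    simp only [Set.mem_preimage, Set.mem_Iic, Finset.sup'_le_iff, Set.mem_pi, Set.mem_univ,
      forall_true_left, Set.mem_ofPred_eq, Finset.mem_filter]
    constructor
    · rintro h y z ⟨hz, rfl⟩
      exact h z hz
    · intro h z hz
      exact h _ z ⟨hz, rfl⟩
  have h2 : (fun y : ℝ => y + Real.log (∑ y, w y)) ⁻¹' Set.Iic t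
      = Set.Iic (t - Real.log (∑ y, w y)) := by
    ext y
    simp [le_sub_iff_add_le]
  rw [h1, h2, Measure.pi_pi, gumbelMeasure_Iic]
  simp only [hw]
  rw [← ENNReal.ofReal_prod_of_nonneg fun _ _ => (Real.exp_pos _).le, ← Real.exp_sum,
    Finset.sum_neg_distrib, ← Finset.sum_mul]
  rw [show -(t - Real.log (∑ y, w y) + Real.eulerMascheroniConstant)
    = Real.log (∑ y, w y) + -(t + Real.eulerMascheroniConstant) by ring, Real.exp_add,
    Real.exp_log hW]

theorem centredMgf_sup'_gumbelMeasure_le {ι κ : Type*} [Fintype κ] (Z : Finset ι)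
    (hZ : Z.Nonempty) (φ : ι → κ) (b : ι → ℝ) {t : ℝ} (ht : |t| ≤ 1 / 2) :
    centredMgf (Measure.pi fun _ : κ => gumbelMeasure)
      (fun s => Z.sup' hZ fun z => b z + s (φ z)) t ≤ Real.exp (4 * t ^ 2) := by
  obtain ⟨m, hm⟩ := map_sup'_gumbelMeasure Z hZ φ b
  have hmeas : Measurable fun s : κ → ℝ => Z.sup' hZ fun z => b z + s (φ z) :=
    (Continuous.finset_sup'_apply hZ fun z _ => by fun_prop).measurable
  rw [← centredMgf_map hmeas, hm, centredMgf_map (by fun_prop), centredMgf,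
    integral_add integrable_id_gumbelMeasure (integrable_const m), integral_id_gumbelMeasure]
  simpa using mgf_gumbelMeasure_le ht

/-! ### Maxima of perturbed scores -/

section MaxValue

variable {n : ℕ} {X : Fin n → Type*}

/-- The score `r z` of a configuration plus the perturbations of the coordinates in `I`. -/
noncomputable def score (r : Config X → ℝ) (I : Finset (Fin n)) (z : Config X) (γ : Pert X) : ℝ :=
  r z + ∑ i ∈ I, γ ⟨i, z i⟩

/-- The maximal perturbed score over a nonempty finite set of configurations. -/
noncomputable def maxValue (Z : Finset (Config X)) (hZ : Z.Nonempty) (r : Config X → ℝ) (I : Finset (Fin n))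
    (γ : Pert X) : ℝ :=
  Z.sup' hZ fun z => score r I z γ

variable {Z : Finset (Config X)} {hZ : Z.Nonempty} {r : Config X → ℝ} {I : Finset (Fin n)}

theorem exists_maxValue_eq (γ : Pert X) : ∃ z ∈ Z, maxValue Z hZ r I γ = score r I z γ :=
  Finset.exists_mem_eq_sup' hZ _

theorem score_le_maxValue {z : Config X} (hz : z ∈ Z) (γ : Pert X) :
    score r I z γ ≤ maxValue Z hZ r I γ :=
  Finset.le_sup' (fun z => score r I z γ) hz

/-- Configurations of score -∞ never attain the maximum of a feasible prefix and can be discarded.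
The default 0 in `unbotD` is therefore never used on `Z`. -/
theorem V_eq_maxValue [∀ i, Fintype (X i)] {θ : Config X → WithBot ℝ} {j : ℕ} {p : Prefix X j}
    (hp : Feasible θ j p) : ∃ (Z : Finset (Config X)) (hZ : Z.Nonempty) (r : Config X → ℝ),
      (∀ z ∈ Z, pre z j = p) ∧
      V θ j p = maxValue Z hZ r (Finset.univ.filter fun i : Fin n => j ≤ (i : ℕ)) := by
  classical
  obtain ⟨z₀, hz₀, hz₀'⟩ := hp
  have hZ : (Finset.univ.filter fun z : Config X => pre z j = p ∧ θ z ≠ ⊥).Nonempty :=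
    ⟨z₀, by simp [hz₀, hz₀']⟩
  refine ⟨_, hZ, fun z => (θ z).unbotD 0, fun z hz => (Finset.mem_filter.1 hz).2.1, ?_⟩
  ext γ
  suffices h : mapValue θ j p γ = ((maxValue _ hZ (fun z => (θ z).unbotD 0)
      (Finset.univ.filter fun i : Fin n => j ≤ (i : ℕ)) γ : ℝ) : WithBot ℝ) by
    rw [V, h, WithBot.unbotD_coe]
  have hval : ∀ z : Config X, θ z ≠ ⊥ → θ z + ((∑ i ∈ Finset.univ.filter
      (fun i : Fin n => j ≤ (i : ℕ)), γ ⟨i, z i⟩ : ℝ) : WithBot ℝ)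
      = ((score (fun z => (θ z).unbotD 0)
        (Finset.univ.filter fun i : Fin n => j ≤ (i : ℕ)) z γ : ℝ) : WithBot ℝ) := by
    intro z hz
    obtain ⟨a, ha⟩ := WithBot.ne_bot_iff_exists.1 hz
    rw [score, ← ha, WithBot.unbotD_coe, WithBot.coe_add]
  rw [mapValue]
  refine le_antisymm (Finset.sup_le fun z hz => ?_) ?_
  · by_cases hb : θ z = ⊥
    · rw [hb, WithBot.bot_add]
      exact bot_le
    · rw [hval z hb, WithBot.coe_le_coe]
      refine score_le_maxValue ?_ γ
      simpa [hb] using hz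
  · obtain ⟨z, hz, h⟩ := exists_maxValue_eq (hZ := hZ) (r := fun z => (θ z).unbotD 0)
      (I := Finset.univ.filter fun i : Fin n => j ≤ (i : ℕ)) γ
    rw [Finset.mem_filter] at hz
    rw [h, ← hval z hz.2.2]
    exact Finset.le_sup (f := fun z => θ z + ((∑ i ∈ Finset.univ.filter
      (fun i : Fin n => j ≤ (i : ℕ)), γ ⟨i, z i⟩ : ℝ) : WithBot ℝ)) (by simp [hz.2.1])

theorem continuous_score (z : Config X) : Continuous (score r I z) := by
  unfold score; fun_prop

theorem measurable_maxValue [∀ i, Fintype (X i)] : Measurable (maxValue Z hZ r I) :=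
  (Continuous.finset_sup'_apply hZ fun z _ => continuous_score z).measurable

/-- Regroups the perturbations into one block per coordinate, so that tensorization produces one
factor per coordinate and not one per pair (i, y). -/
theorem measurePreserving_piCurry_gumbelProduct [∀ i, Fintype (X i)] :
    MeasurePreserving (MeasurableEquiv.piCurry fun (i : Fin n) (_ : X i) => ℝ)
      (gumbelProduct (X := X)) (Measure.pi fun i => Measure.pi fun _ : X i => gumbelMeasure) := by
  refine ⟨MeasurableEquiv.measurable _, ?_⟩
  have h := Measure.infinitePi_map_piCurry (fun (i : Fin n) (_ : X i) => gumbelMeasure)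
  simp only [Measure.infinitePi_eq_pi] at h
  exact h

instance isProbabilityMeasure_gumbelProduct [∀ i, Fintype (X i)] :
    IsProbabilityMeasure (gumbelProduct (X := X)) := by
  unfold gumbelProduct; infer_instance

theorem abs_maxValue_le [∀ i, Fintype (X i)] (γ : Pert X) :
    |maxValue Z hZ r I γ| ≤ ∑ z ∈ Z, |r z| + ∑ i, ∑ y, |γ ⟨i, y⟩| := by
  obtain ⟨z, hz, h⟩ := exists_maxValue_eq (hZ := hZ) (r := r) (I := I) γ
  rw [h, score]
  refine (abs_add_le _ _).trans (add_le_add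
    (Finset.single_le_sum (f := fun z => |r z|) (fun _ _ => abs_nonneg _) hz) ?_)
  calc |∑ i ∈ I, γ ⟨i, z i⟩| ≤ ∑ i ∈ I, |γ ⟨i, z i⟩| := Finset.abs_sum_le_sum_abs _ _
    _ ≤ ∑ i, |γ ⟨i, z i⟩| := Finset.sum_le_sum_of_subset_of_nonneg (Finset.subset_univ I)
        fun _ _ _ => abs_nonneg _
    _ ≤ ∑ i, ∑ y, |γ ⟨i, y⟩| := Finset.sum_le_sum fun i _ =>
        Finset.single_le_sum (f := fun y => |γ ⟨i, y⟩|) (fun _ _ => abs_nonneg _)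
          (Finset.mem_univ (z i))

theorem expDom_gumbelProduct [∀ i, Fintype (X i)] {c : ℝ} (hc : |c| < 1) :
    ExpDom (gumbelProduct (X := X)) c (fun γ => ∑ i, ∑ y, |γ ⟨i, y⟩|) := by
  have h := ExpDom.pi (μ := fun _ : Σ i, X i => gumbelMeasure)
    fun _ => expDom_abs_gumbelMeasure hc
  simp only [Fintype.sum_sigma] at h
  exact h

theorem integrable_maxValue [∀ i, Fintype (X i)] :
    Integrable (maxValue Z hZ r I) gumbelProduct :=
  (expDom_gumbelProduct (c := 0) (by simp)).integrable_of_le measurable_maxValue abs_maxValue_le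

theorem integrable_exp_maxValue [∀ i, Fintype (X i)] {t : ℝ} (ht : |t| < 1) :
    Integrable (fun γ => Real.exp (t * maxValue Z hZ r I γ)) gumbelProduct :=
  (expDom_gumbelProduct (c := |t|) (by rwa [abs_abs])).integrable_exp_of_le le_rfl
    measurable_maxValue abs_maxValue_le

/-- As a function of block `i` alone, the maximum is a shifted Gumbel maximum if `i ∈ I` and
constant otherwise, so exactly `I.card` blocks contribute 4t². -/
theorem centredMgf_maxValue_le [∀ i, Fintype (X i)] {t : ℝ} (ht : |t| ≤ 1 / 4) :
    centredMgf gumbelProduct (maxValue Z hZ r I) t ≤ Real.exp (4 * I.card * t ^ 2) := by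
  classical
  set e := MeasurableEquiv.piCurry fun (i : Fin n) (_ : X i) => ℝ with he
  have hcomp : maxValue Z hZ r I = (maxValue Z hZ r I ∘ e.symm) ∘ e := by
    ext γ
    simp
  rw [hcomp, centredMgf_comp measurePreserving_piCurry_gumbelProduct e.measurableEmbedding]
  have hsum : (4 * I.card * t ^ 2 : ℝ) = ∑ i, if i ∈ I then 4 * t ^ 2 else 0 := by
    rw [Finset.sum_ite_mem, Finset.univ_inter, Finset.sum_const, nsmul_eq_mul]
    ring
  rw [hsum]
  refine centredMgf_pi_le (c := 1 / 4) ht _ (g := fun i s => ∑ y, |s y|)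
    -- Tensorization with c = 1/4 requires envelope moments of order 1/2, below the critical order 1
    -- of the Gumbel law.
    (fun i => ExpDom.pi fun _ => expDom_abs_gumbelMeasure
      (by rw [abs_of_nonneg] <;> norm_num))
    (measurable_maxValue.comp e.symm.measurable) (fun x => abs_maxValue_le _) (fun i x => ?_)
  have hval : ∀ s : X i → ℝ, (maxValue Z hZ r I ∘ e.symm) (Function.update x i s)
      = Z.sup' hZ fun z => r z + ∑ k ∈ I, Function.update x i s k (z k) := fun s => rfl
  simp only [hval]
  split_ifs with hi
  · refine le_of_eq_of_le ?_ (centredMgf_sup'_gumbelMeasure_le Z hZ (fun z => z i)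
      (fun z => r z + ∑ k ∈ I.erase i, x k (z k)) (by linarith))
    congr 1
    ext s
    congr 1
    ext z
    rw [← Finset.add_sum_erase _ _ hi, Function.update_self,
      Finset.sum_congr rfl fun k hk => by rw [Function.update_of_ne (Finset.ne_of_mem_erase hk)]]
    ring
  · have hconst : ∀ (s : X i → ℝ) (z : Config X),
        ∑ k ∈ I, Function.update x i s k (z k) = ∑ k ∈ I, x k (z k) := fun s z =>
      Finset.sum_congr rfl fun k hk => by
        rw [Function.update_of_ne (by rintro rfl; exact hi hk)]
    simp only [hconst]
    simp [centredMgf]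

end MaxValue

/-! ### The gradient of the maximum -/

section Gradient

variable {n : ℕ} {X : Fin n → Type*} [∀ i, Fintype (X i)]
  {Z : Finset (Config X)} {hZ : Z.Nonempty} {r : Config X → ℝ} {I : Finset (Fin n)}

/-- The perturbation at (i, z i) enters the score of `z` and not that of `z'`. Given all the others,
a tie forces it to equal one specific number, which has probability 0. -/
theorem ae_score_ne {z z' : Config X} {i : Fin n} (hi : i ∈ I) (hz : z i ≠ z' i) :
    ∀ᵐ γ ∂(gumbelProduct (X := X)), score r I z γ ≠ score r I z' γ := by
  classical
  set N : Set (Pert X) := {γ | score r I z γ = score r I z' γ} with hN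
  have hNm : MeasurableSet N := (isClosed_eq (continuous_score z) (continuous_score z')).measurableSet
  have hz1 : ∀ (γ : Pert X) (u : ℝ), score r I z (Function.update γ ⟨i, z i⟩ u)
      = r z + (u + ∑ k ∈ I.erase i, γ ⟨k, z k⟩) := fun γ u => by
    rw [score, ← Finset.add_sum_erase _ _ hi, Function.update_self]
    congr 2
    refine Finset.sum_congr rfl fun k hk => Function.update_of_ne (fun h => ?_) _ _
    exact Finset.ne_of_mem_erase hk (congrArg Sigma.fst h)
  have hz2 : ∀ (γ : Pert X) (u : ℝ), score r I z' (Function.update γ ⟨i, z i⟩ u)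
      = score r I z' γ := fun γ u => by
    rw [score, score]
    congr 1
    refine Finset.sum_congr rfl fun k _ => Function.update_of_ne (fun h => ?_) _ _
    obtain rfl : k = i := congrArg Sigma.fst h
    exact hz (eq_of_heq (Sigma.mk.inj h).2).symm
  have hzero : ∫⁻ γ, N.indicator 1 γ ∂(gumbelProduct (X := X))
      = ∫⁻ _, 0 ∂(gumbelProduct (X := X)) := by
    refine lintegral_eq_of_lmarginal_eq {⟨i, z i⟩} (measurable_one.indicator hNm)
      measurable_const ?_
    rw [lmarginal_singleton, lmarginal_singleton]
    ext γ
    refine lintegral_congr_ae ?_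
    have hae : ∀ᵐ u ∂gumbelMeasure,
        u ≠ score r I z' γ - r z - ∑ k ∈ I.erase i, γ ⟨k, z k⟩ := by
      rw [ae_iff]
      simp
    filter_upwards [hae] with u hu
    refine Set.indicator_of_notMem (fun hmem => hu ?_) _
    have h : score r I z (Function.update γ ⟨i, z i⟩ u)
      = score r I z' (Function.update γ ⟨i, z i⟩ u) := hmem
    rw [hz1, hz2] at h
    linarith
  rw [lintegral_zero, lintegral_indicator_one hNm] at hzero
  exact measure_eq_zero_iff_ae_notMem.1 hzero

theorem hasFDerivAt_score (z : Config X) (γ : Pert X) :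
    HasFDerivAt (score r I z)
      (∑ i ∈ I, ContinuousLinearMap.proj (R := ℝ) (φ := fun _ : Σ i, X i => ℝ) ⟨i, z i⟩) γ := by
  refine HasFDerivAt.const_add _ (HasFDerivAt.fun_sum fun i _ => ?_)
  exact (ContinuousLinearMap.proj (R := ℝ) (φ := fun _ : Σ i, X i => ℝ) ⟨i, z i⟩).hasFDerivAt

/-- A strict maximizer among finitely many continuous scores remains one nearby, so the maximum
coincides locally with its score. -/
theorem exists_hasFDerivAt_maxValue {γ : Pert X}
    (h : ∀ z ∈ Z, ∀ z' ∈ Z, z ≠ z' → score r I z γ ≠ score r I z' γ) :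
    ∃ z ∈ Z, HasFDerivAt (maxValue Z hZ r I)
      (∑ i ∈ I, ContinuousLinearMap.proj (R := ℝ) (φ := fun _ : Σ i, X i => ℝ) ⟨i, z i⟩) γ := by
  obtain ⟨z, hz, hmax⟩ := exists_maxValue_eq (hZ := hZ) (r := r) (I := I) γ
  refine ⟨z, hz, (hasFDerivAt_score (r := r) z γ).congr_of_eventuallyEq ?_⟩
  have hev : ∀ᶠ γ' in nhds γ, ∀ z' ∈ Z, score r I z' γ' ≤ score r I z γ' := by
    rw [Filter.eventually_all_finset]
    intro z' hz'
    by_cases hzz : z' = z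
    · rw [hzz]
      exact Eventually.of_forall fun _ => le_rfl
    · have hlt : score r I z' γ < score r I z γ :=
        lt_of_le_of_ne (hmax ▸ score_le_maxValue hz' γ) (h z' hz' z hz hzz)
      exact ((continuous_score z').continuousAt.eventually_lt
        (continuous_score z).continuousAt hlt).mono fun _ h => h.le
  filter_upwards [hev] with γ' hγ'
  exact le_antisymm (Finset.sup'_le hZ _ hγ') (score_le_maxValue hz γ')

open Classical in
theorem grad_eq_of_hasFDerivAt {f : Pert X → ℝ} {z : Config X} {γ : Pert X}
    (h : HasFDerivAt f
      (∑ i ∈ I, ContinuousLinearMap.proj (R := ℝ) (φ := fun _ : Σ i, X i => ℝ) ⟨i, z i⟩) γ)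
    (i : Fin n) (y : X i) : grad f γ ⟨i, y⟩ = if i ∈ I ∧ z i = y then 1 else 0 := by
  rw [grad, h.fderiv, sum_apply]
  simp only [ContinuousLinearMap.proj_apply]
  have hterm : ∀ k, (Pi.single (⟨i, y⟩ : Σ i, X i) (1 : ℝ) : Pert X) ⟨k, z k⟩
      = if k = i then (if z i = y then 1 else 0) else 0 := by
    intro k
    rw [Pi.single_apply]
    by_cases hk : k = i
    · subst hk
      simp
    · simp [hk]
  simp only [hterm, Finset.sum_ite_eq']
  rw [ite_and]

/-- Almost surely the gradient is the indicator of the pairs (i, z i), `i ∈ I`, for the unique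
maximizer `z`. The separation hypothesis excludes candidates that agree on all perturbed
coordinates, whose scores could tie permanently. -/
theorem ae_grad_maxValue (hI : I.Nonempty)
    (hsep : ∀ z ∈ Z, ∀ z' ∈ Z, z ≠ z' → ∃ i ∈ I, z i ≠ z' i) :
    ∀ᵐ γ ∂(gumbelProduct (X := X)), DifferentiableAt ℝ (maxValue Z hZ r I) γ ∧
      ∑ s, grad (maxValue Z hZ r I) γ s ^ 2 = (I.card : ℝ) ∧
      ‖grad (maxValue Z hZ r I) γ‖ = 1 := by
  classical
  have hae : ∀ᵐ γ ∂(gumbelProduct (X := X)),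
      ∀ z ∈ Z, ∀ z' ∈ Z, z ≠ z' → score r I z γ ≠ score r I z' γ := by
    simp only [Filter.eventually_all_finset, Filter.eventually_imp_distrib_left]
    intro z hz z' hz' hne
    obtain ⟨i, hi, h⟩ := hsep z hz z' hz' hne
    exact ae_score_ne hi h
  filter_upwards [hae] with γ hγ
  obtain ⟨z, -, hz⟩ := exists_hasFDerivAt_maxValue (hZ := hZ) hγ
  have hgrad := grad_eq_of_hasFDerivAt hz
  refine ⟨hz.differentiableAt, ?_, le_antisymm ?_ ?_⟩
  · rw [Fintype.sum_sigma]
    simp only [hgrad, ite_and, ite_pow, one_pow, ne_eq, OfNat.ofNat_ne_zero, not_false_eq_true,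
      zero_pow]
    simp [Finset.sum_ite_mem]
  · refine (pi_norm_le_iff_of_nonneg zero_le_one).2 fun ⟨i, y⟩ => ?_
    rw [hgrad]
    split_ifs <;> simp
  · obtain ⟨i, hi⟩ := hI
    have h1 := norm_le_pi_norm (grad (maxValue Z hZ r I) γ) ⟨i, z i⟩
    rw [hgrad, if_pos ⟨hi, rfl⟩] at h1
    simpa using h1

end Gradient

/-! ### Deviation bounds -/

section Deviation

variable {Ω : Type*} [MeasurableSpace Ω] {P : Measure Ω}

/-- With B the error bound, tB - 5dt² is maximal at t = B/(10d), with value B²/(20d); the square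
root in B is made for this. If B ≥ d, this t leaves the admissible range and t = 1/10 gives at least
B/20, which the linear term of B handles. -/
theorem exists_chernoff_parameter {d : ℝ} (hd : 0 < d) {M : ℕ} (hM : 0 < M) {δ : ℝ} (hδ : 0 < δ)
    (hδ1 : δ < 1) : ∃ t : ℝ, 0 ≤ t ∧ t ≤ 1 / 10 ∧
      Real.log (2 / δ) ≤ t * (M * errBound d M δ) - M * (5 * d * t ^ 2) := by
  set L := Real.log (2 / δ) with hL
  set B := errBound d M δ with hB
  have hMr : (0 : ℝ) < M := by exact_mod_cast hM
  have hLpos : 0 < L := Real.log_pos (by rw [lt_div_iff₀ hδ]; linarith)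
  have h1 : 20 / (M : ℝ) * L ≤ B := le_max_left _ _
  have h2 : Real.sqrt (20 * d / (M : ℝ) * L) ≤ B := le_max_right _ _
  have hB0 : 0 < B := lt_of_lt_of_le (by positivity) h1
  rw [Real.sqrt_le_left hB0.le] at h2
  have h3 : 20 * L ≤ M * B := by
    rw [div_mul_eq_mul_div, div_le_iff₀ hMr] at h1
    linarith
  have h4 : 20 * d * L ≤ M * B ^ 2 := by
    rw [div_mul_eq_mul_div, div_le_iff₀ hMr] at h2
    linarith
  rcases le_total B d with h | h
  · refine ⟨B / (10 * d), by positivity, ?_, ?_⟩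
    · rw [div_le_div_iff₀ (by positivity) (by norm_num)]
      linarith
    · have : B / (10 * d) * (M * B) - M * (5 * d * (B / (10 * d)) ^ 2)
          = M * B ^ 2 / (20 * d) := by
        field_simp
        ring
      rw [this, le_div_iff₀ (by positivity)]
      linarith
  · refine ⟨1 / 10, by norm_num, le_rfl, ?_⟩
    have : (M : ℝ) * d ≤ M * B := mul_le_mul_of_nonneg_left h hMr.le
    linarith

theorem measureReal_errBound_le_sampleMean {d : ℝ} (hd : 0 < d) {M : ℕ} (hM : 0 < M) {δ : ℝ}
    (hδ : 0 < δ) (hδ1 : δ < 1) {U : Fin M → Ω → ℝ} (hU : iIndepFun U P)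
    (hm : ∀ k, AEMeasurable (U k) P)
    (hi : ∀ t : ℝ, |t| ≤ 1 / 10 → ∀ k, Integrable (fun ω => Real.exp (t * U k ω)) P)
    (hmgf : ∀ t : ℝ, |t| ≤ 1 / 10 → ∀ k, mgf (U k) P t ≤ Real.exp (5 * d * t ^ 2)) :
    P.real {ω | errBound d M δ ≤ sampleMean fun k => U k ω} ≤ δ / 2 := by
  have : IsProbabilityMeasure P := hU.isProbabilityMeasure
  have hMr : (0 : ℝ) < M := by exact_mod_cast hM
  obtain ⟨t, ht0, ht, hL⟩ := exists_chernoff_parameter hd hM hδ hδ1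
  have hta : |t| ≤ 1 / 10 := by rwa [abs_of_nonneg ht0]
  have hprod := hU.mgf_sum₀ (t := t) hm Finset.univ
  -- `mgf` is 0 when the exponential is not integrable, so positivity of the product of the factors
  -- proves integrability for the sum.
  have hint : Integrable (fun ω => Real.exp (t * (∑ k, U k) ω)) P := by
    rw [← mgf_pos_iff, hprod]
    exact Finset.prod_pos fun k _ => mgf_pos (hi t hta k)
  have hset : {ω | errBound d M δ ≤ sampleMean fun k => U k ω}
      = {ω | M * errBound d M δ ≤ (∑ k, U k) ω} := by
    ext ω
    simp only [Set.mem_ofPred_eq, sampleMean, Finset.sum_apply]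
    rw [one_div, inv_mul_eq_div, le_div_iff₀' hMr]
  rw [hset]
  calc P.real {ω | M * errBound d M δ ≤ (∑ k, U k) ω}
      ≤ Real.exp (-t * (M * errBound d M δ)) * mgf (∑ k, U k) P t :=
        measure_ge_le_exp_mul_mgf _ ht0 hint
    _ ≤ Real.exp (-t * (M * errBound d M δ)) * Real.exp (5 * d * t ^ 2) ^ M := by
        rw [hprod]
        refine mul_le_mul_of_nonneg_left ?_ (Real.exp_pos _).le
        calc ∏ k, mgf (U k) P t ≤ ∏ _k : Fin M, Real.exp (5 * d * t ^ 2) :=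
              Finset.prod_le_prod (fun _ _ => mgf_nonneg) fun k _ => hmgf t hta k
          _ = Real.exp (5 * d * t ^ 2) ^ M := by simp
    _ = Real.exp (-(t * (M * errBound d M δ) - M * (5 * d * t ^ 2))) := by
        rw [← Real.exp_nat_mul, ← Real.exp_add]
        congr 1
        ring
    _ ≤ Real.exp (-Real.log (2 / δ)) := Real.exp_le_exp.2 (neg_le_neg hL)
    _ = δ / 2 := by
        rw [← Real.log_inv, Real.exp_log (by positivity), inv_div]

theorem measureReal_errBound_lt_abs_sampleMean {d : ℝ} (hd : 0 < d) {M : ℕ} (hM : 0 < M) {δ : ℝ}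
    (hδ : 0 < δ) (hδ1 : δ < 1) {U : Fin M → Ω → ℝ} (hU : iIndepFun U P)
    (hm : ∀ k, AEMeasurable (U k) P)
    (hi : ∀ t : ℝ, |t| ≤ 1 / 10 → ∀ k, Integrable (fun ω => Real.exp (t * U k ω)) P)
    (hmgf : ∀ t : ℝ, |t| ≤ 1 / 10 → ∀ k, mgf (U k) P t ≤ Real.exp (5 * d * t ^ 2)) :
    P.real {ω | errBound d M δ < |sampleMean fun k => U k ω|} ≤ δ := by
  have : IsProbabilityMeasure P := hU.isProbabilityMeasure
  have h1 := measureReal_errBound_le_sampleMean hd hM hδ hδ1 hU hm hi hmgf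
  have h2 := measureReal_errBound_le_sampleMean hd hM hδ hδ1 (U := fun k => -U k)
    (hU.comp (fun _ y => -y) fun _ => measurable_neg) (fun k => (hm k).neg)
    (fun t ht k => by simpa using hi (-t) (by rwa [abs_neg]) k)
    (fun t ht k => by
      rw [mgf_neg, ← neg_sq t]
      exact hmgf (-t) (by rwa [abs_neg]) k)
  have hsub : {ω | errBound d M δ < |sampleMean fun k => U k ω|}
      ⊆ {ω | errBound d M δ ≤ sampleMean fun k => U k ω}
        ∪ {ω | errBound d M δ ≤ sampleMean fun k => (-U k) ω} := by
    intro ω hω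
    have hneg : (sampleMean fun k => (-U k) ω) = -sampleMean fun k => U k ω := by
      simp [sampleMean]
    rw [Set.mem_union, Set.mem_ofPred_eq, Set.mem_ofPred_eq, hneg]
    exact (lt_abs.1 hω).imp le_of_lt le_of_lt
  linarith [measureReal_mono (μ := P) hsub, measureReal_union_le
    {ω | errBound d M δ ≤ sampleMean fun k => U k ω}
    {ω | errBound d M δ ≤ sampleMean fun k => (-U k) ω} (μ := P)]

theorem eventually_errBound_le {δ : ℝ} {ε : ℝ} (hε : 0 < ε) (d : ℝ) :
    ∀ᶠ M : ℕ in atTop, errBound d M δ ≤ ε := by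
  have h (a : ℝ) : Tendsto (fun M : ℕ => a / (M : ℝ) * Real.log (2 / δ)) atTop (nhds 0) := by
    simpa using (tendsto_const_div_atTop_nhds_zero_nat a).mul_const (Real.log (2 / δ))
  have h1 := (h 20).max ((Real.continuous_sqrt.tendsto 0).comp (h (20 * d)))
  rw [Real.sqrt_zero, max_self] at h1
  exact h1.eventually_le_const hε

/-- Union bound carried out on the complement with subadditivity only, so neither `A` nor the bad
events need be measurable. -/
theorem one_sub_le_measureReal_of_ae [IsProbabilityMeasure P] {ι : Type*} [Fintype ι] {δ : ℝ}
    {bad : ι → Set Ω} (hbad : ∀ i, P.real (bad i) ≤ δ) {A : Set Ω}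
    (hA : ∀ᵐ ω ∂P, (∀ i, ω ∉ bad i) → ω ∈ A) : 1 - Fintype.card ι * δ ≤ P.real A := by
  have h1 : P.real Aᶜ ≤ P.real (⋃ i, bad i) := by
    refine ENNReal.toReal_mono (measure_ne_top _ _) (measure_mono_ae ?_)
    filter_upwards [hA] with ω hω hωA
    by_contra hc
    exact hωA (hω fun i hi => hc (Set.mem_iUnion.2 ⟨i, hi⟩))
  have h2 : P.real (⋃ i, bad i) ≤ Fintype.card ι * δ :=
    (measureReal_iUnion_fintype_le bad).trans
      ((Finset.sum_le_sum fun i _ => hbad i).trans_eq (by simp))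
  have h3 : P.real Set.univ ≤ P.real A + P.real Aᶜ := by
    rw [← Set.union_compl_self A]
    exact measureReal_union_le _ _
  rw [probReal_univ] at h3
  linarith

theorem sampleMean_sub_const {M : ℕ} (hM : 0 < M) (w : Fin M → ℝ) (a : ℝ) :
    (sampleMean fun k => w k - a) = sampleMean w - a := by
  have hMr : (M : ℝ) ≠ 0 := by exact_mod_cast hM.ne'
  simp only [sampleMean, Finset.sum_sub_distrib, Finset.sum_const, Finset.card_univ,
    Fintype.card_fin, nsmul_eq_mul]
  field_simp

end Deviation

/-! ### The MAP values and the sampler -/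

section Sampler

theorem pre_update_self {n : ℕ} {X : Fin n → Type*} (x : Config X) (i : Fin n) (y : X i) :
    pre (Function.update x i y) i = pre x i := by
  funext k
  exact Function.update_of_ne (fun h => absurd k.2 (by rw [h]; exact lt_irrefl _)) _ _

variable {n : ℕ} {X : Fin n → Type*} [∀ i, Fintype (X i)] {θ : Config X → WithBot ℝ}
  {Ω : Type*} [MeasurableSpace Ω] {P : Measure Ω} {j : ℕ}

theorem card_filter_le_fin (hj : j ≤ n) :
    ((Finset.univ.filter fun i : Fin n => j ≤ (i : ℕ)).card : ℝ) = (n : ℝ) - j := by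
  rw [← Nat.cast_sub hj]
  congr 1
  have h := Finset.card_filter_add_card_filter_not (s := (Finset.univ : Finset (Fin n)))
    (fun i => (i : ℕ) < j)
  rw [Fin.card_filter_val_lt, Finset.card_univ, Fintype.card_fin, min_eq_right hj] at h
  simp only [not_lt] at h
  omega

theorem integrable_V {p : Prefix X j} (hp : Feasible θ j p) :
    Integrable (V θ j p) gumbelProduct := by
  obtain ⟨Z, hZ, r, -, hV⟩ := V_eq_maxValue hp
  rw [hV]
  exact integrable_maxValue

theorem integrable_exp_V_sub_EV {p : Prefix X j} (hp : Feasible θ j p) {t : ℝ} (ht : |t| < 1) :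
    Integrable (fun γ => Real.exp (t * (V θ j p γ - EV θ j p))) gumbelProduct := by
  obtain ⟨Z, hZ, r, -, hV⟩ := V_eq_maxValue hp
  simp only [mul_sub, Real.exp_sub]
  rw [hV]
  exact (integrable_exp_maxValue ht).div_const _

theorem mgf_V_sub_EV_le (hj : j ≤ n) {p : Prefix X j} (hp : Feasible θ j p) {t : ℝ}
    (ht : |t| ≤ 1 / 4) : mgf (fun γ => V θ j p γ - EV θ j p) gumbelProduct t
      ≤ Real.exp (4 * ((n : ℝ) - j) * t ^ 2) := by
  obtain ⟨Z, hZ, r, -, hV⟩ := V_eq_maxValue hp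
  have h := centredMgf_maxValue_le (hZ := hZ) (r := r)
    (I := Finset.univ.filter fun i : Fin n => j ≤ (i : ℕ)) ht
  rwa [← hV, card_filter_le_fin hj] at h

theorem ae_grad_V (hj : j < n) {p : Prefix X j} (hp : Feasible θ j p) :
    ∀ᵐ γ ∂(gumbelProduct (X := X)), DifferentiableAt ℝ (V θ j p) γ ∧
      ∑ s, grad (V θ j p) γ s ^ 2 = (n : ℝ) - j ∧ ‖grad (V θ j p) γ‖ = 1 := by
  obtain ⟨Z, hZ, r, hpre, hV⟩ := V_eq_maxValue hp
  rw [hV, ← card_filter_le_fin hj.le]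
  refine ae_grad_maxValue ⟨⟨j, hj⟩, by simp⟩ fun z hz z' hz' hne => ?_
  obtain ⟨i, hi⟩ := Function.ne_iff.1 hne
  refine ⟨i, ?_, hi⟩
  rw [Finset.mem_filter]
  refine ⟨Finset.mem_univ i, not_lt.1 fun hlt => hi ?_⟩
  exact congrFun ((hpre z hz).trans (hpre z' hz').symm) ⟨i, hlt⟩

theorem measureReal_errBound_lt_abs_sampleMean_V (hj : j < n) {p : Prefix X j}
    (hp : Feasible θ j p) {M : ℕ} (hM : 0 < M) {δ : ℝ} (hδ : 0 < δ) (hδ1 : δ < 1)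
    {U : Fin M → Ω → ℝ}
    (hU : IsIIDCopies P U (fun γ => V θ j p γ - EV θ j p) gumbelProduct) :
    P.real {ω | errBound ((n : ℝ) - j) M δ < |sampleMean fun k => U k ω|} ≤ δ := by
  have hd : (0 : ℝ) < (n : ℝ) - j := sub_pos.2 (by exact_mod_cast hj)
  refine measureReal_errBound_lt_abs_sampleMean hd hM hδ hδ1 hU.1
    (fun k => (hU.2 k).aemeasurable_fst) (fun t ht k => ?_) (fun t ht k => ?_)
  · exact ((hU.2 k).comp (u := fun y => Real.exp (t * y)) (by fun_prop)).integrable_iff.2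
      (integrable_exp_V_sub_EV hp (by linarith))
  · rw [mgf_congr_identDistrib (hU.2 k)]
    -- The constant 4 is relaxed to 5, which fits the 20 = 4 · 5 in `errBound`.
    refine (mgf_V_sub_EV_le hj.le hp (by linarith)).trans (Real.exp_le_exp.2 ?_)
    have : 0 ≤ ((n : ℝ) - j) * t ^ 2 := by positivity
    linarith

theorem measureReal_lt_abs_sampleMean_sub_EV (hj : j < n) {p : Prefix X j} (hp : Feasible θ j p)
    {M : ℕ} (hM : 0 < M) {δ ε : ℝ} (hδ : 0 < δ) (hδ1 : δ < 1)
    (hε : errBound ((n : ℝ) - j) M δ ≤ ε) {W : Fin M → Ω → ℝ}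
    (hW : IsIIDCopies P W (V θ j p) gumbelProduct) :
    P.real {ω | ε < |(sampleMean fun k => W k ω) - EV θ j p|} ≤ δ := by
  have : IsProbabilityMeasure P := hW.1.isProbabilityMeasure
  have hm : Measurable fun y : ℝ => y - EV θ j p := measurable_id.sub_const _
  refine le_trans (measureReal_mono fun ω hω => ?_) (measureReal_errBound_lt_abs_sampleMean_V hj hp
    hM hδ hδ1 (U := fun k ω => W k ω - EV θ j p)
    ⟨hW.1.comp (fun _ y => y - EV θ j p) fun _ => hm, fun k => (hW.2 k).comp hm⟩)
  rw [Set.mem_ofPred_eq, sampleMean_sub_const hM]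
  exact hε.trans_lt hω

/-- With all coordinates fixed no perturbation is left, so the value is constant and the sample mean
is almost surely exact. -/
theorem ae_sampleMean_eq_EV {p : Prefix X n} (hp : Feasible θ n p) {M : ℕ} (hM : 0 < M)
    {W : Fin M → Ω → ℝ} (hW : IsIIDCopies P W (V θ n p) gumbelProduct) :
    ∀ᵐ ω ∂P, (sampleMean fun k => W k ω) = EV θ n p := by
  obtain ⟨Z, hZ, r, -, hV⟩ := V_eq_maxValue hp
  have hempty : (Finset.univ.filter fun i : Fin n => n ≤ (i : ℕ)) = ∅ :=
    Finset.filter_eq_empty_iff.2 fun i _ => not_le.2 i.2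
  have hconst : ∀ γ, V θ n p γ = V θ n p 0 := fun γ => by
    rw [hV, hempty]
    simp [maxValue, score]
  have hEV : EV θ n p = V θ n p 0 := by
    simp [EV, hconst]
  have hae : ∀ᵐ ω ∂P, ∀ k, W k ω = EV θ n p := ae_all_iff.2 fun k =>
    (hW.2 k).symm.ae_snd (p := fun y => y = EV θ n p) (measurableSet_singleton _)
      (Eventually.of_forall fun γ => (hconst γ).trans hEV.symm)
  filter_upwards [hae] with ω hω
  have hMr : (M : ℝ) ≠ 0 := by exact_mod_cast hM.ne'
  simp only [sampleMean, hω, Finset.sum_const, Finset.card_univ, Fintype.card_fin, nsmul_eq_mul]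
  field_simp

theorem estimatedProb_div_samplerProb {M : ℕ → ℕ} {w : ∀ j : ℕ, Prefix X j → Fin (M j) → ℝ}
    {x : Config X} {ε : ℝ} (hx : Feasible θ (j + 1) (pre x (j + 1)))
    (h0 : |sampleMean (w j (pre x j)) - EV θ j (pre x j)| ≤ ε)
    (h1 : |sampleMean (w (j + 1) (pre x (j + 1))) - EV θ (j + 1) (pre x (j + 1))| ≤ ε) :
    Real.exp (-2 * ε) ≤ estimatedProb θ w j x / samplerProb θ j x ∧
      estimatedProb θ w j x / samplerProb θ j x ≤ Real.exp (2 * ε) := by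
  rw [estimatedProb, samplerProb, if_pos hx, if_pos hx, ← Real.exp_sub, ← Real.exp_sub,
    ← Real.exp_sub, Real.exp_le_exp, Real.exp_le_exp]
  rw [abs_le] at h0 h1
  constructor <;> linarith

variable [IsProbabilityMeasure P] {δ ε : ℝ} {M : ℕ → ℕ}
  {W : (j : ℕ) → Prefix X j → Fin (M j) → Ω → ℝ}

/-- The prefixes of lengths 0, ..., n occur, but length n is exact almost surely; this leaves `n`
bad events. -/
theorem one_sub_le_measureReal_sampler_accurate (hδ : 0 < δ) (hδ1 : δ < 1) (hε : 0 < ε)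
    (hM : ∀ j : ℕ, j ≤ n → 0 < M j)
    (hB : ∀ j : ℕ, j < n → errBound ((n : ℝ) - j) (M j) δ ≤ ε)
    (hW : ∀ j : ℕ, j ≤ n → ∀ p : Prefix X j, Feasible θ j p →
      IsIIDCopies P (W j p) (V θ j p) gumbelProduct)
    {x : Config X} (hx : θ x ≠ ⊥) :
    1 - n * δ ≤ P.real {ω | ∀ j : ℕ, j < n →
      Real.exp (-2 * ε) ≤
        estimatedProb θ (fun j p k => W j p k ω) j x / samplerProb θ j x ∧
      estimatedProb θ (fun j p k => W j p k ω) j x / samplerProb θ j x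
        ≤ Real.exp (2 * ε)} := by
  have hf : ∀ j, Feasible θ j (pre x j) := fun j => ⟨x, rfl, hx⟩
  have h := one_sub_le_measureReal_of_ae (P := P) (ι := Fin n) (δ := δ)
    (bad := fun i => {ω | ε < |(sampleMean fun k => W i (pre x i) k ω) - EV θ i (pre x i)|})
    (A := {ω | ∀ j : ℕ, j < n → Real.exp (-2 * ε) ≤
        estimatedProb θ (fun j p k => W j p k ω) j x / samplerProb θ j x ∧
      estimatedProb θ (fun j p k => W j p k ω) j x / samplerProb θ j x
        ≤ Real.exp (2 * ε)})
    (fun i => measureReal_lt_abs_sampleMean_sub_EV i.2 (hf i) (hM i i.2.le) hδ hδ1 (hB i i.2)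
      (hW i i.2.le _ (hf i))) ?_
  · rwa [Fintype.card_fin] at h
  filter_upwards [ae_sampleMean_eq_EV (hf n) (hM n le_rfl) (hW n le_rfl _ (hf n))] with ω hω hbad
  have hgood : ∀ j, j ≤ n →
      |(sampleMean fun k => W j (pre x j) k ω) - EV θ j (pre x j)| ≤ ε := by
    intro j hj
    rcases hj.lt_or_eq with hj | rfl
    · exact not_lt.1 (hbad ⟨j, hj⟩)
    · rw [hω, sub_self, abs_zero]
      exact hε.le
  exact fun j hj => estimatedProb_div_samplerProb (hf _) (hgood j hj.le) (hgood (j + 1) hj)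

theorem one_sub_le_measureReal_sampler_accurate_all (hδ : 0 < δ) (hδ1 : δ < 1) (hε : 0 < ε)
    (hM : ∀ j : ℕ, j ≤ n → 0 < M j)
    (hB : ∀ j : ℕ, j < n → errBound ((n : ℝ) - j) (M j) δ ≤ ε)
    (hW : ∀ j : ℕ, j ≤ n → ∀ p : Prefix X j, Feasible θ j p →
      IsIIDCopies P (W j p) (V θ j p) gumbelProduct)
    {x : Config X} (hx : θ x ≠ ⊥) :
    1 - (∑ i, (Fintype.card (X i) : ℝ)) * δ ≤ P.real {ω | ∀ j : Fin n, ∀ y : X j,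
      Feasible θ (j + 1) (pre (Function.update x j y) (j + 1)) →
      Real.exp (-2 * ε) ≤
        estimatedProb θ (fun j p k => W j p k ω) j (Function.update x j y)
          / samplerProb θ j (Function.update x j y) ∧
      estimatedProb θ (fun j p k => W j p k ω) j (Function.update x j y)
          / samplerProb θ j (Function.update x j y)
        ≤ Real.exp (2 * ε)} := by
  have hf : ∀ j, Feasible θ j (pre x j) := fun j => ⟨x, rfl, hx⟩
  set good : (j : ℕ) → Prefix X j → Ω → Prop := fun j p ω =>
    |(sampleMean fun k => W j p k ω) - EV θ j p| ≤ ε with hgood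
  have hmeas : ∀ j, j < n → ∀ p, P.real {ω | Feasible θ j p ∧ ¬ good j p ω} ≤ δ := by
    intro j hj p
    by_cases hp : Feasible θ j p
    · simpa only [hp, true_and, hgood, not_le] using
        measureReal_lt_abs_sampleMean_sub_EV hj hp (hM j hj.le) hδ hδ1 (hB j hj)
          (hW j hj.le p hp)
    · simpa [hp] using hδ.le
  have h := one_sub_le_measureReal_of_ae (P := P) (ι := Σ i, X i) (δ := δ)
    -- The pair (i, y) accounts for the prefix of `x` of length i extended by y. Pairs with i + 1 =
    -- n would give full-length prefixes, which are almost surely exact, so their slots are reused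
    -- for the empty prefix. The count thus stays at the sum of the |X i|.
    (bad := fun s => {ω | if (s.1 : ℕ) + 1 < n then
        Feasible θ (s.1 + 1) (pre (Function.update x s.1 s.2) (s.1 + 1)) ∧
          ¬ good (s.1 + 1) (pre (Function.update x s.1 s.2) (s.1 + 1)) ω
      else Feasible θ 0 (pre x 0) ∧ ¬ good 0 (pre x 0) ω})
    (A := {ω | ∀ j : Fin n, ∀ y : X j,
      Feasible θ (j + 1) (pre (Function.update x j y) (j + 1)) →
      Real.exp (-2 * ε) ≤
        estimatedProb θ (fun j p k => W j p k ω) j (Function.update x j y)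
          / samplerProb θ j (Function.update x j y) ∧
      estimatedProb θ (fun j p k => W j p k ω) j (Function.update x j y)
          / samplerProb θ j (Function.update x j y)
        ≤ Real.exp (2 * ε)}) (fun s => ?_) ?_
  · rwa [Fintype.card_sigma, Nat.cast_sum] at h
  · split_ifs with hs
    · exact hmeas _ hs _
    · exact hmeas 0 (by have := s.1.2; omega) _
  have hlast : ∀ᵐ ω ∂P, ∀ p : Prefix X n, Feasible θ n p → good n p ω := by
    refine ae_all_iff.2 fun p => ?_
    by_cases hp : Feasible θ n p
    · filter_upwards [ae_sampleMean_eq_EV hp (hM n le_rfl) (hW n le_rfl _ hp)] with ω hω _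
      simp only [hgood, hω, sub_self, abs_zero]
      exact hε.le
    · exact Eventually.of_forall fun ω h => absurd h hp
  filter_upwards [hlast] with ω hω hbad
  have hsucc : ∀ (i : Fin n) (y : X i),
      Feasible θ (i + 1) (pre (Function.update x i y) (i + 1)) →
      good (i + 1) (pre (Function.update x i y) (i + 1)) ω := by
    intro i y hy
    rcases (Nat.succ_le_of_lt i.2).lt_or_eq with hi | hi
    · have := hbad ⟨i, y⟩
      rw [if_pos hi] at this
      exact not_not.1 fun hc => this ⟨hy, hc⟩
    -- The length is generalized to `m` because the type of the prefix depends on it.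
    · have key : ∀ (m : ℕ), m = n → ∀ p : Prefix X m, Feasible θ m p → good m p ω := by
        rintro m rfl
        exact hω
      exact key _ hi _ hy
  have hpre : ∀ j, j < n → good j (pre x j) ω := by
    intro j hj
    rcases j with _ | j
    · have hlt : n - 1 < n := by omega
      -- The slot for the empty prefix exists because `x` supplies an element of the last factor.
      have := hbad ⟨⟨n - 1, hlt⟩, x _⟩
      rw [if_neg (by simp only; omega)] at this
      exact not_not.1 fun hc => this ⟨hf 0, hc⟩
    · have := hsucc ⟨j, by omega⟩ (x _)
      rw [Function.update_eq_self] at this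
      exact this (hf _)
  intro j y hy
  refine estimatedProb_div_samplerProb hy ?_ (hsucc j y hy)
  rw [pre_update_self]
  exact hpre j j.2

end Sampler

end MapPert

theorem mainTheorem5 {n : ℕ} {X : Fin n → Type*} [∀ i, Fintype (X i)]
    (θ : MapPert.Config X → WithBot ℝ)
    {Ω : Type*} [MeasurableSpace Ω] (P : Measure Ω) [IsProbabilityMeasure P] :
    -- the MAP values are integrable
    (∀ j : ℕ, j ≤ n → ∀ p : MapPert.Prefix X j, MapPert.Feasible θ j p →
      Integrable (MapPert.V θ j p) MapPert.gumbelProduct) ∧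
    -- the gradient of the MAP value: squared Euclidean norm `n - j` and sup norm `1`
    (∀ j : ℕ, j < n → ∀ p : MapPert.Prefix X j, MapPert.Feasible θ j p →
      ∀ᵐ γ ∂(MapPert.gumbelProduct (X := X)),
        DifferentiableAt ℝ (MapPert.V θ j p) γ ∧
        ∑ s, MapPert.grad (MapPert.V θ j p) γ s ^ 2 = (n : ℝ) - j ∧
        ‖MapPert.grad (MapPert.V θ j p) γ‖ = 1) ∧
    -- the two-sided deviation bound
    (∀ j : ℕ, j < n → ∀ p : MapPert.Prefix X j, MapPert.Feasible θ j p →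
      ∀ M : ℕ, 0 < M → ∀ δ : ℝ, 0 < δ → δ < 1 →
      ∀ U : Fin M → Ω → ℝ,
        MapPert.IsIIDCopies P U (fun γ => MapPert.V θ j p γ - MapPert.EV θ j p)
          MapPert.gumbelProduct →
        1 - δ ≤ P.real {ω | |MapPert.sampleMean (fun k => U k ω)|
          ≤ MapPert.errBound ((n : ℝ) - j) M δ}) ∧
    -- the sample sizes can be chosen so that the error bound is at most `ε`
    (∀ δ : ℝ, 0 < δ → δ < 1 → ∀ ε : ℝ, 0 < ε → ∀ j : ℕ, j < n →
      ∀ᶠ M : ℕ in atTop, MapPert.errBound ((n : ℝ) - j) M δ ≤ ε) ∧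
    -- with such sample sizes, the estimated sampler probabilities are accurate
    (∀ δ : ℝ, 0 < δ → δ < 1 → ∀ ε : ℝ, 0 < ε →
      ∀ M : ℕ → ℕ, (∀ j : ℕ, j ≤ n → 0 < M j) →
      (∀ j : ℕ, j < n → MapPert.errBound ((n : ℝ) - j) (M j) δ ≤ ε) →
      ∀ W : (j : ℕ) → MapPert.Prefix X j → Fin (M j) → Ω → ℝ,
      (∀ j : ℕ, j ≤ n → ∀ p : MapPert.Prefix X j, MapPert.Feasible θ j p →
        MapPert.IsIIDCopies P (W j p) (MapPert.V θ j p) MapPert.gumbelProduct) →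
      ∀ x : MapPert.Config X, θ x ≠ ⊥ →
        -- along the configuration `x`
        1 - n * δ ≤ P.real {ω | ∀ j : ℕ, j < n →
          Real.exp (-2 * ε) ≤
            MapPert.estimatedProb θ (fun j p k => W j p k ω) j x / MapPert.samplerProb θ j x ∧
          MapPert.estimatedProb θ (fun j p k => W j p k ω) j x / MapPert.samplerProb θ j x
            ≤ Real.exp (2 * ε)} ∧
        -- along `x`, for all candidate values `y` of the next coordinate at once
        1 - (∑ i, (Fintype.card (X i) : ℝ)) * δ ≤ P.real {ω | ∀ j : Fin n, ∀ y : X j,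
          MapPert.Feasible θ (j + 1) (MapPert.pre (Function.update x j y) (j + 1)) →
          Real.exp (-2 * ε) ≤
            MapPert.estimatedProb θ (fun j p k => W j p k ω) j (Function.update x j y)
              / MapPert.samplerProb θ j (Function.update x j y) ∧
          MapPert.estimatedProb θ (fun j p k => W j p k ω) j (Function.update x j y)
              / MapPert.samplerProb θ j (Function.update x j y)
            ≤ Real.exp (2 * ε)}) := by
  refine ⟨fun j _ p hp => MapPert.integrable_V hp, fun j hj p hp => MapPert.ae_grad_V hj hp,
    fun j hj p hp M hM δ hδ hδ1 U hU => ?_,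
    fun δ _ _ ε hε j _ => MapPert.eventually_errBound_le hε _,
    fun δ hδ hδ1 ε hε M hM hB W hW x hx =>
      ⟨MapPert.one_sub_le_measureReal_sampler_accurate hδ hδ1 hε hM hB hW hx,
        MapPert.one_sub_le_measureReal_sampler_accurate_all hδ hδ1 hε hM hB hW hx⟩⟩
  -- Passing to the complement is a union bound with a single bad event, which avoids a
  -- measurability argument.
  have h := MapPert.one_sub_le_measureReal_of_ae (ι := Unit)
    (fun _ => MapPert.measureReal_errBound_lt_abs_sampleMean_V hj hp hM hδ hδ1 hU)
    (A := {ω | |MapPert.sampleMean (fun k => U k ω)| ≤ MapPert.errBound ((n : ℝ) - j) M δ})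
    (Filter.Eventually.of_forall fun ω hω => by
      rw [Set.mem_ofPred_eq]
      exact not_lt.1 (hω ()))
  simpa using h
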